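/- **Setting.** All Hilbert spaces are finite-dimensional over $\mathbb C$; states are density operators (positive semidefinite, trace one); channels are completely positive trace-preserving linear maps. A *generalized divergence* is a function $\mathbf D(\rho\Vert\sigma)\in[-\infty,\infty]$ of pairs of operators on an arbitrary space such that $\mathbf D(\mathcal N(\rho)\Vert\mathcal N(\sigma))\le\mathbf D(\rho\Vert\sigma)$ for all states $\rho,\sigma$ and all channels $\mathcal N$. For $k\ge2$, a state $\rho_{AB}$ is *$k$-extendible*, $\rho_{AB}\in\mathrm{EXT}_k(A{:}B)$, if there is a state $\omega_{AB_1\cdots B_k}$ (each $B_i\simeq B$), invariant under all permutations of $B_1,\dots,B_k$, with $\operatorname{Tr}_{B_2\cdots B_k}\omega=\rho_{AB}$. For a function $\mathbf D$ as above (monotone or not) put $\mathbf E_k^{\mathbf D}(A;B)_\rho=\inf_{\sigma\in\mathrm{EXT}_k(A:B)}\mathbf D(\rho\Vert\sigma)$. For $p,q\in[0,1]$ write $\mathbf D(p\Vert q)=\mathbf D(\kappa(p)\Vert\kappa(q))$ with $\kappa(x)=x|0\rangle\langle0|+(1-x)|1\rangle\langle1|$. Let $d\ge2$, $k\ge2$,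 $\dim A=\dim B=d$, let $F$ be the swap operator, $\Pi^\pm=(I\pm F)/2$ and $\Phi^d=\frac1d\sum_{i,j}|i\rangle\langle j|\otimes|i\rangle\langle j|$. For $p,t\in[0,1]$ let $$W^{(p,d)}=(1-p)\tfrac{2}{d(d+1)}\Pi^++p\tfrac{2}{d(d-1)}\Pi^-,\qquad \rho^{(t,d)}=t\,\Phi^d+(1-t)\tfrac{I-\Phi^d}{d^2-1}$$ be the Werner and isotropic states, and set $w=\frac12\left(\frac{d-1}{k}+1\right)$ and $s=\frac1d\left(\frac{d-1}{k}+1\right)$ (so $s<1$). **Proposition.** (1) For every generalized divergence $\mathbf D$ and all $p,t\in[0,1]$, $$\mathbf E_k^{\mathbf D}(A;B)_{W^{(p,d)}}=\inf_{q\in[0,\min\{1,w\}]}\mathbf D(p\Vert q),\qquad \mathbf E_k^{\mathbf D}(A;B)_{\rho^{(t,d)}}=\inf_{q\in[0,s]}\mathbf D(t\Vert q).$$ (2) Let $\mathbf D$ be one of the following: the relative entropy $D(\rho\Vert\sigma)=\operatorname{Tr}[\rho(\log_2\rho-\log_2\sigma)]$ ($+\infty$ if $\operatorname{supp}\rho\not\subseteq\operatorname{supp}\sigma$);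 the Rényi relative entropy $D_\alpha(\rho\Vert\sigma)=\frac1{\alpha-1}\log_2\operatorname{Tr}[\rho^\alpha\sigma^{1-\alpha}]$ with $\alpha\in(0,1)\cup(1,\infty)$; or the sandwiched Rényi relative entropy $\widetilde D_\alpha(\rho\Vert\sigma)=\frac1{\alpha-1}\log_2\operatorname{Tr}\big[\big(\sigma^{\frac{1-\alpha}{2\alpha}}\rho\,\sigma^{\frac{1-\alpha}{2\alpha}}\big)^\alpha\big]$ with $\alpha\in[\frac12,1)\cup(1,\infty)$. (The Rényi quantities are $+\infty$ if $\alpha>1$ and $\operatorname{supp}\rho\not\subseteq\operatorname{supp}\sigma$, or if the trace is $0$; logarithms and negative powers are taken on supports.) Then for all $p,t\in[0,1]$ $$\mathbf E_k^{\mathbf D}(A;B)_{W^{(p,d)}}=\begin{cases}0,&p\le w,\\ \mathbf D(p\Vert w),&p>w,\end{cases}\qquad \mathbf E_k^{\mathbf D}(A;B)_{\rho^{(t,d)}}=\begin{cases}0,&t\le s,\\ \mathbf D(t\Vert s),&t>s.\end{cases}$$ Here, for $p\in[0,1]$ and $q\in(0,1)$, $D(p\Vert q)=p\log_2\frac pq+(1-p)\log_2\frac{1-p}{1-q}$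 (with $0\log_2 0=0$) and, for all $\alpha\in(0,1)\cup(1,\infty)$, $D_\alpha(p\Vert q)=\widetilde D_\alpha(p\Vert q)=\frac1{\alpha-1}\log_2\big(p^\alpha q^{1-\alpha}+(1-p)^\alpha(1-q)^{1-\alpha}\big)$. -/

import Mathlib

open scoped ComplexOrder

noncomputable section

namespace Unext

/-- `ρ` is a density operator (in an orthonormal basis indexed by `n`):
positive semidefinite with unit trace. -/
def IsDensity {n : Type} [Fintype n] (ρ : Matrix n n ℂ) : Prop :=
  ρ.PosSemidef ∧ ρ.trace = 1

/-- The map `id_r ⊗ N` on `r × r` block matrices: `N` is applied to each of the blocks. -/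
def ampliation {n m : Type} (N : Matrix n n ℂ →ₗ[ℂ] Matrix m m ℂ) (r : ℕ)
    (X : Matrix (Fin r × n) (Fin r × n) ℂ) : Matrix (Fin r × m) (Fin r × m) ℂ :=
  fun x y => N (fun a b => X (x.1, a) (y.1, b)) x.2 y.2

/-- Quantum channels: completely positive, trace-preserving linear maps. -/
def IsChannel {n m : Type} [Fintype n] [Fintype m]
    (N : Matrix n n ℂ →ₗ[ℂ] Matrix m m ℂ) : Prop :=
  (∀ (r : ℕ) (X : Matrix (Fin r × n) (Fin r × n) ℂ),
      X.PosSemidef → (ampliation N r X).PosSemidef) ∧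
  ∀ X : Matrix n n ℂ, (N X).trace = X.trace

/-- An extended-real-valued function of pairs of operators on finite-dimensional Hilbert spaces.
Only its values at positive semidefinite arguments (the first one a state) are ever meaningful. -/
abbrev DivergenceFamily : Type 1 :=
  ∀ (n : Type) [Fintype n] [DecidableEq n], Matrix n n ℂ → Matrix n n ℂ → EReal

/-- A generalized divergence: a function that satisfies the data-processing inequality for all
states and all quantum channels, possibly between different spaces. -/
def IsGeneralizedDivergence (D : DivergenceFamily) : Prop :=
  ∀ (n m : Type) [Fintype n] [DecidableEq n] [Fintype m] [DecidableEq m]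
    (N : Matrix n n ℂ →ₗ[ℂ] Matrix m m ℂ) (ρ σ : Matrix n n ℂ),
    IsChannel N → IsDensity ρ → IsDensity σ → D m (N ρ) (N σ) ≤ D n ρ σ

/-- The partial trace over all the systems `B_j`, `j ≠ i`, of an operator on `A B_1 ⋯ B_k`. -/
def marginal {A B : Type} [Fintype B] [DecidableEq B] {k : ℕ} (i : Fin k)
    (ω : Matrix (A × (Fin k → B)) (A × (Fin k → B)) ℂ) : Matrix (A × B) (A × B) ℂ :=
  fun x y => ∑ f : Fin k → B with f i = x.2, ω (x.1, f) (y.1, Function.update f i y.2)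

/-- Invariance under all the unitaries that permute the systems `B_1, …, B_k`
(they permute the elements of the product basis). -/
def PermInvariant {A B : Type} {k : ℕ}
    (ω : Matrix (A × (Fin k → B)) (A × (Fin k → B)) ℂ) : Prop :=
  ∀ (π : Equiv.Perm (Fin k)) (a a' : A) (f g : Fin k → B),
    ω (a, f ∘ π) (a', g ∘ π) = ω (a, f) (a', g)

/-- The set `EXT_k(A;B)` of `k`-extendible states (`B` is the extended system, `k ≥ 2`). -/
def EXT (A B : Type) [Fintype A] [Fintype B] [DecidableEq B] (k : ℕ) (hk : 2 ≤ k) :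
    Set (Matrix (A × B) (A × B) ℂ) :=
  {ρ | IsDensity ρ ∧
    ∃ ω : Matrix (A × (Fin k → B)) (A × (Fin k → B)) ℂ,
      IsDensity ω ∧ PermInvariant ω ∧ marginal ⟨0, by omega⟩ ω = ρ}

/-- The `k`-unextendible divergence `E_k(A;B)_ρ` built from `D`. -/
def unextDiv (D : DivergenceFamily) {A B : Type} [Fintype A] [Fintype B]
    [DecidableEq A] [DecidableEq B] (k : ℕ) (hk : 2 ≤ k)
    (ρ : Matrix (A × B) (A × B) ℂ) : EReal :=
  ⨅ σ ∈ EXT A B k hk, D (A × B) ρ σ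

/-- The operator `κ(x) = x |0⟩⟨0| + (1 - x) |1⟩⟨1|`. -/
def kappa (x : ℝ) : Matrix (Fin 2) (Fin 2) ℂ :=
  Matrix.diagonal ![(x : ℂ), 1 - (x : ℂ)]

/-- The abbreviation `D(p‖q) = D(κ(p)‖κ(q))`. -/
def binaryDiv (D : DivergenceFamily) (p q : ℝ) : EReal :=
  D (Fin 2) (kappa p) (kappa q)

/-- The swap operator `F |a⟩|b⟩ = |b⟩|a⟩`. -/
def swapOp (d : ℕ) : Matrix (Fin d × Fin d) (Fin d × Fin d) ℂ :=
  fun x y => if x.1 = y.2 ∧ x.2 = y.1 then 1 else 0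

/-- The projection `(I + F)/2` onto the symmetric subspace. -/
def symProj (d : ℕ) : Matrix (Fin d × Fin d) (Fin d × Fin d) ℂ :=
  (1 / 2 : ℝ) • (1 + swapOp d)

/-- The projection `(I - F)/2` onto the antisymmetric subspace. -/
def antiProj (d : ℕ) : Matrix (Fin d × Fin d) (Fin d × Fin d) ℂ :=
  (1 / 2 : ℝ) • (1 - swapOp d)

/-- The Werner state `W^{(p,d)}`. -/
def werner (p : ℝ) (d : ℕ) : Matrix (Fin d × Fin d) (Fin d × Fin d) ℂ :=
  ((1 - p) * (2 / ((d : ℝ) * ((d : ℝ) + 1)))) • symProj d +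
    (p * (2 / ((d : ℝ) * ((d : ℝ) - 1)))) • antiProj d

/-- The maximally entangled state `Φ^d = (1/d) ∑_{i,j} |i⟩⟨j| ⊗ |i⟩⟨j|`. -/
def maxEnt (d : ℕ) : Matrix (Fin d × Fin d) (Fin d × Fin d) ℂ :=
  fun x y => if x.1 = x.2 ∧ y.1 = y.2 then 1 / (d : ℂ) else 0

/-- The isotropic state `ρ^{(t,d)}`. -/
def isotropic (t : ℝ) (d : ℕ) : Matrix (Fin d × Fin d) (Fin d × Fin d) ℂ :=
  t • maxEnt d + ((1 - t) / ((d : ℝ) ^ 2 - 1)) • (1 - maxEnt d)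

/-- `supp ρ ⊆ supp σ`, where the support is the orthogonal complement of the kernel. -/
def SuppLE {n : Type} [Fintype n] (ρ σ : Matrix n n ℂ) : Prop :=
  ∀ v : n → ℂ, σ.mulVec v = 0 → ρ.mulVec v = 0

/-- Real powers of a positive semidefinite operator by functional calculus; for `s ≠ 0` the kernel
is mapped to `0` (since `0 ^ s = 0` in `ℝ`), so negative powers are taken on the support. -/
def rpowOp {n : Type} [Fintype n] [DecidableEq n] (σ : Matrix n n ℂ) (s : ℝ) : Matrix n n ℂ :=
  cfc (fun x : ℝ => x ^ s) σ

/-- Base-2 logarithm of a positive semidefinite operator, taken on the support. -/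
def log2Op {n : Type} [Fintype n] [DecidableEq n] (σ : Matrix n n ℂ) : Matrix n n ℂ :=
  cfc (fun x : ℝ => Real.logb 2 x) σ

open Classical in
/-- The quantum relative entropy. -/
def relEntropy : DivergenceFamily := fun _ _ _ ρ σ =>
  if SuppLE ρ σ then (((ρ * (log2Op ρ - log2Op σ)).trace.re : ℝ) : EReal) else ⊤

open Classical in
/-- `(α - 1)⁻¹ log₂ Q` with the value `+∞` if `α > 1` and `supp ρ ⊄ supp σ`, and also if `Q = 0`
(which happens only for `α < 1` and orthogonal supports, or when the support condition fails). -/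
def renyiOf {n : Type} [Fintype n] (α : ℝ) (ρ σ : Matrix n n ℂ) (Q : ℝ) : EReal :=
  if (1 < α ∧ ¬ SuppLE ρ σ) ∨ Q = 0 then ⊤ else ((1 / (α - 1) * Real.logb 2 Q : ℝ) : EReal)

/-- The (traditional, or Petz) Rényi relative entropy
`D_α(ρ‖σ) = (α - 1)⁻¹ log₂ Tr[ρ^α σ^(1-α)]`. -/
def renyi (α : ℝ) : DivergenceFamily := fun _ _ _ ρ σ =>
  renyiOf α ρ σ (rpowOp ρ α * rpowOp σ (1 - α)).trace.re

/-- The sandwiched Rényi relative entropy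
`(α - 1)⁻¹ log₂ Tr[(σ^((1-α)/(2α)) ρ σ^((1-α)/(2α)))^α]`. -/
def sandwichedRenyi (α : ℝ) : DivergenceFamily := fun _ _ _ ρ σ =>
  renyiOf α ρ σ
    (rpowOp (rpowOp σ ((1 - α) / (2 * α)) * ρ * rpowOp σ ((1 - α) / (2 * α))) α).trace.re

/-- The threshold `½((d-1)/k + 1)`. -/
def wernerThr (d k : ℕ) : ℝ := (1 / 2) * (((d : ℝ) - 1) / (k : ℝ) + 1)

/-- The threshold `(1/d)((d-1)/k + 1)`. -/
def isoThr (d k : ℕ) : ℝ := (1 / (d : ℝ)) * (((d : ℝ) - 1) / (k : ℝ) + 1)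

open Classical in
/-- The closed form: `0` below the threshold `s`, and `D(p‖s)` above it. -/
def closedForm (D : DivergenceFamily) (s p : ℝ) : EReal :=
  if p ≤ s then 0 else binaryDiv D p s

/-- `D` has the closed form on all Werner states and on all isotropic states of local
dimension `d`. -/
def HasClosedForms (D : DivergenceFamily) (d k : ℕ) (hk : 2 ≤ k) : Prop :=
  (∀ p ∈ Set.Icc (0 : ℝ) 1, unextDiv D k hk (werner p d) = closedForm D (wernerThr d k) p) ∧
  (∀ t ∈ Set.Icc (0 : ℝ) 1, unextDiv D k hk (isotropic t d) = closedForm D (isoThr d k) t)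

end Unext

end

noncomputable section

namespace Unext

open Matrix

/-! ### Tangent lines of power functions and of the logarithm -/

/-! Werner and isotropic states are scalar on the two blocks of a projection `P` (the antisymmetric
projection, respectively `Φ^d`), so each is labelled by its weight `Tr Pρ`. Measuring `{P, 1 - P}`
and preparing the normalized blocks of another such projection is a channel whose output depends on
a state only through its weight. Hence a generalized divergence of block states is a binary
quantity, and part (1) reduces to two facts: the weight of an extendible state is at most the
threshold, and every block state with weight up to `min 1 threshold` is extendible
(`iInf_generalizedDivergence`).

Both facts come from the spectrum of `K = ∑ᵢ M_{ABᵢ}` (`embSum`), where `M` is the swap or `d Φ^d`.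
If `ω` extends `σ`, then `k Tr(Mσ) = Tr(ωK)`, so extreme eigenvalues of `K` bound the weight
(`trace_mul_le_of_mem_EXT`). Conversely, a normalized eigenprojection of `K` is permutation
invariant and commutes with whatever commutes with `K`. Its marginal therefore commutes with all `X
⊗ 1 + 1 ⊗ X` (respectively `-Xᵀ ⊗ 1 + 1 ⊗ X`), which forces it to be a block state whose weight is
read off from the eigenvalue (`exists_mem_EXT_of_eigenvector`, `exists_eq_of_commute`). Convexity
fills the interval between two such weights. No average over the unitary group is needed.

For the swap, `K` is a Jucys–Murphy element: its eigenvalues are at least `-(d-1)`, as highest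
weight vectors show, and explicit vectors realize `k` and `-min(d-1,k)`. For `d Φ^d`, a maximum
principle bounds the eigenvalues by `d+k-1`; this value and `0` are realized.

Part (2) cannot rest on data processing, which fails for the Petz quantity with `α > 2`. Instead,
the logarithm or power of `σ` is replaced on each block by its tangent line at the eigenvalue `w/r`
of the block state of weight `w`. The two blocks together give the binary quantity at `w` plus a
correction in `Tr Pσ - w`, whose sign is favourable when `Tr Pσ ≤ w ≤ p` or `w = p`
(`Comparable.mul_sub_rpow_nonpos`). -/

lemma one_add_mul_le_rpow_of_nonpos {u β : ℝ} (hu : 0 < u) (hβ : β ≤ 0) :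
    1 + β * (u - 1) ≤ u ^ β := by
  rw [Real.rpow_def_of_pos hu]
  -- `u^β ≥ 1 + β log u ≥ 1 + β (u - 1)`; the second inequality uses `β ≤ 0`.
  nlinarith [Real.add_one_le_exp (Real.log u * β), Real.log_le_sub_one_of_pos hu]

/-- The base has the shape `1 + s` with `s ≥ -1` in which Bernoulli's inequality applies. -/
lemma rpow_eq_mul_div_rpow {x y : ℝ} (hx : 0 ≤ x) (hy : 0 < y) (β : ℝ) :
    x ^ β = y ^ β * (1 + (x / y - 1)) ^ β := by
  rw [← Real.mul_rpow hy.le (by have := div_nonneg hx hy.le; linarith)]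
  congr 1
  field_simp
  ring

lemma rpow_tangent_eq {x y : ℝ} (hy : 0 < y) (β : ℝ) :
    y ^ β + β * y ^ (β - 1) * (x - y) = y ^ β * (1 + β * (x / y - 1)) := by
  rw [Real.rpow_sub_one hy.ne']
  field_simp

/-- The graph of a convex power function lies above its tangent lines. -/
lemma rpow_tangent_le {x y β : ℝ} (hx : 0 ≤ x) (hy : 0 < y)
    (h : (β ≤ 0 ∧ x ≠ 0) ∨ 1 ≤ β) : y ^ β + β * y ^ (β - 1) * (x - y) ≤ x ^ β := by
  rw [rpow_tangent_eq hy, rpow_eq_mul_div_rpow hx hy]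
  have hxy := div_nonneg hx hy.le
  refine mul_le_mul_of_nonneg_left ?_ (Real.rpow_nonneg hy.le _)
  rcases h with ⟨hβ, hx0⟩ | hβ
  · have : 0 < x / y := div_pos (lt_of_le_of_ne hx (Ne.symm hx0)) hy
    simpa using one_add_mul_le_rpow_of_nonpos this hβ
  · exact one_add_mul_self_le_rpow_one_add (by linarith) hβ

/-- The graph of a concave power function lies below its tangent lines. -/
lemma rpow_le_tangent {x y β : ℝ} (hx : 0 ≤ x) (hy : 0 < y) (h0 : 0 ≤ β) (h1 : β ≤ 1) :
    x ^ β ≤ y ^ β + β * y ^ (β - 1) * (x - y) := by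
  rw [rpow_tangent_eq hy, rpow_eq_mul_div_rpow hx hy]
  have hxy := div_nonneg hx hy.le
  exact mul_le_mul_of_nonneg_left
    (rpow_one_add_le_one_add_mul_self (by linarith) h0 h1) (Real.rpow_nonneg hy.le _)

lemma log_le_tangent {x y : ℝ} (hx : 0 < x) (hy : 0 < y) :
    Real.log x ≤ Real.log y + 1 / y * (x - y) := by
  have h := Real.log_le_sub_one_of_pos (div_pos hx hy)
  rw [Real.log_div hx.ne' hy.ne'] at h
  have : 1 / y * (x - y) = x / y - 1 := by field_simp
  linarith

/-! ### Functional calculus and traces -/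

lemma trace_re_nonneg {n : Type} [Fintype n] {A : Matrix n n ℂ} (hA : A.PosSemidef) :
    0 ≤ A.trace.re :=
  (Complex.le_def.1 hA.trace_nonneg).1

section Matrices

variable {n : Type} [Fintype n] [DecidableEq n]

lemma continuousOn_spectrum (A : Matrix n n ℂ) (f : ℝ → ℝ) : ContinuousOn f (spectrum ℝ A) :=
  Matrix.finite_real_spectrum.continuousOn f

lemma continuousOn_image_spectrum (A : Matrix n n ℂ) (f g : ℝ → ℝ) :
    ContinuousOn f (g '' spectrum ℝ A) :=
  (Matrix.finite_real_spectrum.image g).continuousOn f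

lemma spectrum_nonneg_of_posSemidef {A : Matrix n n ℂ} (hA : A.PosSemidef) {x : ℝ}
    (hx : x ∈ spectrum ℝ A) : 0 ≤ x := by
  rw [hA.isHermitian.spectrum_real_eq_range_eigenvalues] at hx
  obtain ⟨i, rfl⟩ := hx
  exact hA.eigenvalues_nonneg i

lemma cfc_isHermitian (f : ℝ → ℝ) (A : Matrix n n ℂ) : (cfc f A).IsHermitian :=
  (cfc_predicate f A : IsSelfAdjoint (cfc f A))

/-- Traces against functions of a positive semidefinite `σ`, written with the spectral weights
of `P` in an eigenbasis of `σ`. -/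
lemma exists_spectral_weights {σ P : Matrix n n ℂ} (hσ : σ.PosSemidef) (hP : P.PosSemidef) :
    ∃ l w : n → ℝ, (∀ j, 0 ≤ l j) ∧ (∀ j, 0 ≤ w j) ∧
      (∀ f : ℝ → ℝ, (P * cfc f σ).trace.re = ∑ j, w j * f (l j)) ∧
      (SuppLE P σ → ∀ j, l j = 0 → w j = 0) := by
  have hH := hσ.isHermitian
  set U : Matrix n n ℂ := (hH.eigenvectorUnitary : Matrix n n ℂ) with hU
  -- The weights are `⟨uⱼ, P uⱼ⟩` for the eigenbasis `uⱼ` of `σ`. If `lⱼ = 0` then `σ uⱼ = 0`, and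
  -- the support inclusion gives `P uⱼ = 0`.
  refine ⟨hH.eigenvalues, fun j => ((Uᴴ * P * U) j j).re, hσ.eigenvalues_nonneg, ?_, ?_, ?_⟩
  · intro j
    exact (Complex.le_def.1 (hP.conjTranspose_mul_mul_same U).diag_nonneg).1
  · intro f
    rw [hH.cfc_eq f, Matrix.IsHermitian.cfc, Unitary.conjStarAlgAut_apply, ← mul_assoc,
      Matrix.trace_mul_comm, ← mul_assoc, ← mul_assoc, Matrix.star_eq_conjTranspose,
      Matrix.trace, Complex.re_sum]
    refine Finset.sum_congr rfl fun j _ => ?_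
    simp [Matrix.diag, Matrix.mul_diagonal, hU]
  · intro hs j hj
    have h0 : σ *ᵥ (hH.eigenvectorBasis j).ofLp = 0 := by
      rw [hH.mulVec_eigenvectorBasis, hj, zero_smul]
    have h1 : (P * U).col j = 0 := by
      rw [← hs _ h0]
      ext i
      simp [Matrix.col, Matrix.mul_apply, Matrix.mulVec, dotProduct, hU]
    have h2 : (Uᴴ * P * U) j j = 0 := by
      rw [mul_assoc, Matrix.mul_apply]
      refine Finset.sum_eq_zero fun i _ => ?_
      have := congrFun h1 i
      simp only [Matrix.col_apply, Pi.zero_apply] at this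
      rw [this, mul_zero]
    simp only [h2, Complex.zero_re]

/-- If `f` lies above an affine function, so do its traces. -/
lemma affine_le_trace_mul_cfc {σ P : Matrix n n ℂ} (hσ : σ.PosSemidef) (hP : P.PosSemidef)
    {f : ℝ → ℝ} {a b : ℝ} (hf : ∀ x, 0 ≤ x → (SuppLE P σ → x ≠ 0) → a + b * x ≤ f x) :
    a * P.trace.re + b * (P * σ).trace.re ≤ (P * cfc f σ).trace.re := by
  obtain ⟨l, w, hl, hw, htr, hs⟩ := exists_spectral_weights hσ hP
  have h1 := htr fun _ => 1
  have h2 := htr fun x => x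
  rw [cfc_const_one ℝ σ hσ.isHermitian.isSelfAdjoint, mul_one] at h1
  rw [cfc_id' ℝ σ hσ.isHermitian.isSelfAdjoint] at h2
  rw [h1, h2, htr f, Finset.mul_sum, Finset.mul_sum, ← Finset.sum_add_distrib]
  refine Finset.sum_le_sum fun j _ => ?_
  -- Under the support inclusion a kernel vector of `σ` has weight zero. So the point `0`, where
  -- logarithms and negative powers take a default value violating the bound, never contributes.
  by_cases hj : w j = 0
  · simp [hj]
  · have := hf (l j) (hl j) fun h h0 => hj (hs h j h0)
    nlinarith [hw j]

/-- If `f` lies below an affine function, so do its traces. -/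
lemma trace_mul_cfc_le_affine {σ P : Matrix n n ℂ} (hσ : σ.PosSemidef) (hP : P.PosSemidef)
    {f : ℝ → ℝ} {a b : ℝ} (hf : ∀ x, 0 ≤ x → (SuppLE P σ → x ≠ 0) → f x ≤ a + b * x) :
    (P * cfc f σ).trace.re ≤ a * P.trace.re + b * (P * σ).trace.re := by
  have := affine_le_trace_mul_cfc hσ hP (f := fun x => -f x) (a := -a) (b := -b)
    fun x hx h => by linarith [hf x hx h]
  rw [cfc_neg, mul_neg, Matrix.trace_neg, Complex.neg_re] at this
  linarith

lemma trace_mul_cfc_nonneg {σ P : Matrix n n ℂ} (hσ : σ.PosSemidef) (hP : P.PosSemidef)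
    {f : ℝ → ℝ} (hf : ∀ x, 0 ≤ x → 0 ≤ f x) : 0 ≤ (P * cfc f σ).trace.re := by
  simpa using affine_le_trace_mul_cfc hσ hP (f := f) (a := 0) (b := 0)
    fun x hx _ => by simpa using hf x hx

lemma trace_mul_re_nonneg {σ P : Matrix n n ℂ} (hσ : σ.PosSemidef) (hP : P.PosSemidef) :
    0 ≤ (P * σ).trace.re := by
  simpa [cfc_id' ℝ σ hσ.isHermitian.isSelfAdjoint] using
    trace_mul_cfc_nonneg hσ hP (f := fun x => x) fun x hx => hx

/-- The nonnegative terms `wⱼ lⱼ` sum to zero, so all the weight of `P` sits on the kernel of `σ`,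
where `f` vanishes. -/
lemma trace_mul_cfc_eq_zero {σ P : Matrix n n ℂ} (hσ : σ.PosSemidef) (hP : P.PosSemidef)
    {f : ℝ → ℝ} (hf : f 0 = 0) (h : (P * σ).trace.re = 0) : (P * cfc f σ).trace.re = 0 := by
  obtain ⟨l, w, hl, hw, htr, -⟩ := exists_spectral_weights hσ hP
  have h2 := htr fun x => x
  rw [cfc_id' ℝ σ hσ.isHermitian.isSelfAdjoint, h,
    eq_comm, Finset.sum_eq_zero_iff_of_nonneg fun j _ => mul_nonneg (hw j) (hl j)] at h2
  rw [htr f]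
  refine Finset.sum_eq_zero fun j hj => ?_
  rcases mul_eq_zero.1 (h2 j hj) with h0 | h0 <;> simp [h0, hf]

/-- Roots of the characteristic polynomial replace eigenvalues because `X * Y` and `Y * X` share
that polynomial. -/
lemma trace_cfc {A : Matrix n n ℂ} (hA : A.IsHermitian) (f : ℝ → ℝ) :
    (cfc f A).trace = (A.charpoly.roots.map fun z => ((f z.re : ℝ) : ℂ)).sum := by
  have h : ∏ i, (Polynomial.X - Polynomial.C ((f (hA.eigenvalues i) : ℝ) : ℂ)) =
      ((Finset.univ.val.map fun i => ((f (hA.eigenvalues i) : ℝ) : ℂ)).map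
        fun z => Polynomial.X - Polynomial.C z).prod := by
    rw [Multiset.map_map]
    rfl
  rw [Matrix.trace_eq_sum_roots_charpoly, hA.charpoly_cfc_eq f]
  erw [h]
  rw [Polynomial.roots_multiset_prod_X_sub_C, hA.roots_charpoly_eq_eigenvalues, Multiset.map_map]
  simp

/-- `Tr f(X Y) = Tr f(Y X)`. -/
lemma trace_cfc_mul_comm {X Y : Matrix n n ℂ} (h : (X * Y).IsHermitian) (h' : (Y * X).IsHermitian)
    (f : ℝ → ℝ) : (cfc f (X * Y)).trace = (cfc f (Y * X)).trace := by
  rw [trace_cfc h, trace_cfc h', Matrix.charpoly_mul_comm]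

end Matrices

/-! ### States that are scalar on the two blocks of a projection -/

section Blocks

variable {n : Type} [Fintype n] [DecidableEq n]

/-- `P` is an orthogonal projection of rank `r > 0` and corank `r' > 0`. -/
structure IsBlockProj (P : Matrix n n ℂ) (r r' : ℝ) : Prop where
  herm : P.IsHermitian
  idem : P * P = P
  pos : 0 < r
  pos' : 0 < r'
  trace : P.trace = (r : ℂ)
  trace' : (1 - P).trace = (r' : ℂ)

/-- The state with weights `p` and `1 - p` that is scalar on the two blocks of `P`. -/
def blockState (P : Matrix n n ℂ) (r r' p : ℝ) : Matrix n n ℂ :=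
  (p / r) • P + ((1 - p) / r') • (1 - P)

omit [DecidableEq n] in
lemma posSemidef_of_idem {P : Matrix n n ℂ} (h : P.IsHermitian) (h2 : P * P = P) :
    P.PosSemidef := by
  have := Matrix.posSemidef_conjTranspose_mul_self P
  rwa [h.eq, h2] at this

namespace IsBlockProj

variable {P : Matrix n n ℂ} {r r' : ℝ}

lemma compl (h : IsBlockProj P r r') : IsBlockProj (1 - P) r' r where
  herm := Matrix.isHermitian_one.sub h.herm
  idem := by simp [mul_sub, sub_mul, h.idem]
  pos := h.pos'
  pos' := h.pos
  trace := h.trace'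
  trace' := by simpa using h.trace

lemma posSemidef (h : IsBlockProj P r r') : P.PosSemidef := posSemidef_of_idem h.herm h.idem

omit [Fintype n] in
lemma blockState_compl (P : Matrix n n ℂ) (r r' p : ℝ) :
    blockState (1 - P) r' r (1 - p) = blockState P r r' p := by
  simp [blockState, add_comm]

lemma mul_compl (h : IsBlockProj P r r') : P * (1 - P) = 0 := by simp [mul_sub, h.idem]

lemma mul_blockState (h : IsBlockProj P r r') (p : ℝ) :
    P * blockState P r r' p = (p / r) • P := by
  simp [blockState, mul_add, h.idem, h.mul_compl]

lemma trace_re (h : IsBlockProj P r r') : P.trace.re = r := by simp [h.trace]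

lemma trace_mul_blockState (h : IsBlockProj P r r') (p : ℝ) :
    (P * blockState P r r' p).trace = p := by
  rw [h.mul_blockState, Matrix.trace_smul, h.trace, Complex.real_smul, ← Complex.ofReal_mul,
    div_mul_cancel₀ _ h.pos.ne']

lemma isDensity_blockState (h : IsBlockProj P r r') {p : ℝ} (hp : p ∈ Set.Icc (0 : ℝ) 1) :
    IsDensity (blockState P r r' p) := by
  constructor
  · exact (h.posSemidef.smul (div_nonneg hp.1 h.pos.le)).add
      (h.compl.posSemidef.smul (div_nonneg (by linarith [hp.2]) h.pos'.le))
  · have h1 := h.trace_mul_blockState p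
    have h2 := h.compl.trace_mul_blockState (1 - p)
    rw [blockState_compl] at h2
    have : blockState P r r' p = P * blockState P r r' p + (1 - P) * blockState P r r' p := by
      rw [← add_mul]; simp
    rw [this, Matrix.trace_add, h1, h2]
    simp

lemma spectrum_subset (h : IsBlockProj P r r') {x : ℝ} (hx : x ∈ spectrum ℝ P) :
    x = 0 ∨ x = 1 := by
  have h1 : cfc (fun x : ℝ => x * x - x) P = 0 := by
    rw [cfc_sub _ _ P (continuousOn_spectrum _ _) (continuousOn_spectrum _ _),
      cfc_mul _ _ P (continuousOn_spectrum _ _) (continuousOn_spectrum _ _),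
      cfc_id' ℝ P h.herm.isSelfAdjoint, h.idem, sub_self]
  have h2 := cfc_map_spectrum (fun x : ℝ => x * x - x) P h.herm.isSelfAdjoint
    (continuousOn_spectrum _ _)
  -- The spectrum of `0` is `{0}` only in a nontrivial ring; positive rank excludes the empty index
  -- type.
  have hne : Nonempty n := by
    by_contra hne
    rw [not_nonempty_iff] at hne
    have := h.trace
    simp [Matrix.trace] at this
    exact h.pos.ne' (Complex.ofReal_eq_zero.1 this.symm)
  rw [h1, spectrum.zero_eq] at h2
  have : x * x - x ∈ ({0} : Set ℝ) := h2 ▸ Set.mem_image_of_mem _ hx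
  have h3 : x * (x - 1) = 0 := by
    rw [Set.mem_singleton_iff] at this
    linarith
  rcases mul_eq_zero.1 h3 with h4 | h4
  · exact Or.inl h4
  · exact Or.inr (by linarith)

/-- On the spectrum, inside `{0, 1}`, the affine function takes the values `b` and `a`. Block-scalar
matrices are thus functions of `P`, and composing functions computes their functional calculus. -/
lemma cfc_indicator (h : IsBlockProj P r r') (a b : ℝ) :
    cfc (fun x : ℝ => b + (a - b) * x) P = a • P + b • (1 - P) := by
  rw [cfc_const_add b (fun x : ℝ => (a - b) * x) P (continuousOn_spectrum _ _)
      h.herm.isSelfAdjoint,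
    cfc_const_mul (a - b) (fun x : ℝ => x) P (continuousOn_spectrum _ _),
    cfc_id' ℝ P h.herm.isSelfAdjoint, Algebra.algebraMap_eq_smul_one, smul_sub, sub_smul]
  abel

/-- Functions of a matrix that is scalar on the two blocks. -/
lemma cfc_block (h : IsBlockProj P r r') (f : ℝ → ℝ) (a b : ℝ) :
    cfc f (a • P + b • (1 - P)) = f a • P + f b • (1 - P) := by
  rw [← h.cfc_indicator, ← h.cfc_indicator,
    ← cfc_comp f (fun x : ℝ => b + (a - b) * x) P h.herm.isSelfAdjoint
      (continuousOn_image_spectrum _ _ _) (continuousOn_spectrum _ _)]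
  refine cfc_congr fun x hx => ?_
  rcases h.spectrum_subset hx with rfl | rfl <;> simp

lemma block_mul (h : IsBlockProj P r r') (a b c d : ℝ) :
    (a • P + b • (1 - P)) * (c • P + d • (1 - P)) = (a * c) • P + (b * d) • (1 - P) := by
  have h1 := h.mul_compl
  have h2 : (1 - P) * P = 0 := by simpa using h.compl.mul_compl
  simp only [add_mul, mul_add, smul_mul_assoc, mul_smul_comm, h1, h2, h.idem, h.compl.idem,
    smul_zero, add_zero, zero_add, smul_smul, mul_comm]

lemma trace_block (h : IsBlockProj P r r') (a b : ℝ) :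
    (a • P + b • (1 - P)).trace.re = a * r + b * r' := by
  rw [Matrix.trace_add, Matrix.trace_smul, Matrix.trace_smul, h.trace, h.trace']
  simp

lemma suppLE_of_blockState (h : IsBlockProj P r r') {p : ℝ} {σ : Matrix n n ℂ} (hp : p ≠ 0)
    (hs : SuppLE (blockState P r r' p) σ) : SuppLE P σ := by
  intro v hv
  have h1 : P *ᵥ (blockState P r r' p *ᵥ v) = 0 := by rw [hs v hv, Matrix.mulVec_zero]
  rw [Matrix.mulVec_mulVec, h.mul_blockState, Matrix.smul_mulVec] at h1
  exact (smul_eq_zero.1 h1).resolve_left (div_ne_zero hp h.pos.ne')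

/-- For `0 < q < 1` the block state is invertible, so the support condition is empty. -/
lemma suppLE_blockState (h : IsBlockProj P r r') (ρ : Matrix n n ℂ) {q : ℝ} (h0 : 0 < q)
    (h1 : q < 1) : SuppLE ρ (blockState P r r' q) := by
  intro v hv
  have hinv : ((r / q) • P + (r' / (1 - q)) • (1 - P)) * blockState P r r' q = 1 := by
    have hr := h.pos.ne'
    have hr' := h.pos'.ne'
    have hq : (1 - q) ≠ 0 := by linarith
    have e1 : r / q * (q / r) = 1 := by field_simp
    have e2 : r' / (1 - q) * ((1 - q) / r') = 1 := by field_simp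
    rw [blockState, h.block_mul, e1, e2]
    simp
  have : v = 0 := by
    rw [← Matrix.one_mulVec v, ← hinv, ← Matrix.mulVec_mulVec, hv, Matrix.mulVec_zero]
  rw [this, Matrix.mulVec_zero]

end IsBlockProj

/-- The projection behind the states `κ(x)`. -/
def kappaProj : Matrix (Fin 2) (Fin 2) ℂ := Matrix.diagonal ![1, 0]

lemma isBlockProj_kappaProj : IsBlockProj kappaProj 1 1 where
  herm := by
    ext i j
    fin_cases i <;> fin_cases j <;> simp [kappaProj]
  idem := by
    ext i j
    fin_cases i <;> fin_cases j <;> simp [kappaProj]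
  pos := one_pos
  pos' := one_pos
  trace := by simp [kappaProj]
  trace' := by simp [kappaProj]; norm_num

lemma kappa_eq_blockState (x : ℝ) : kappa x = blockState kappaProj 1 1 x := by
  ext i j
  fin_cases i <;> fin_cases j <;> simp [kappa, blockState, kappaProj]

end Blocks

/-! ### Measurement and preparation channels -/

section Channels

variable {n m : Type} [Fintype n] [DecidableEq n] [Fintype m] [DecidableEq m]

/-- The map `X ↦ Tr(P X) Q`. -/
def measPrep (P : Matrix n n ℂ) (Q : Matrix m m ℂ) : Matrix n n ℂ →ₗ[ℂ] Matrix m m ℂ where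
  toFun X := (P * X).trace • Q
  map_add' X Y := by simp [mul_add, add_smul]
  map_smul' c X := by simp [mul_smul]

omit [DecidableEq m] in
-- Since `P = P Pᴴ`, the functional `Tr(P ·)` is a sum of compressions to the columns of `P`. Its
-- ampliation is a sum of terms `Vᴴ X V`, followed by a Kronecker product with `Q ≥ 0`.
lemma ampliation_measPrep_posSemidef {P : Matrix n n ℂ} {Q : Matrix m m ℂ}
    (hP : P.IsHermitian) (hP2 : P * P = P) (hQ : Q.PosSemidef) (r : ℕ)
    (X : Matrix (Fin r × n) (Fin r × n) ℂ) (hX : X.PosSemidef) :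
    (ampliation (measPrep P Q) r X).PosSemidef := by
  have h1 : ampliation (measPrep P Q) r X =
      Matrix.kronecker (∑ c : n, (Matrix.of fun (x : Fin r × n) (i : Fin r) =>
        if x.1 = i then P x.2 c else 0)ᴴ * X *
          (Matrix.of fun (x : Fin r × n) (i : Fin r) => if x.1 = i then P x.2 c else 0)) Q := by
    ext ⟨i, a⟩ ⟨j, b⟩
    simp only [ampliation, measPrep, LinearMap.coe_mk, AddHom.coe_mk, Matrix.smul_apply,
      smul_eq_mul, Matrix.kronecker, Matrix.kroneckerMap_apply]
    congr 1
    change (P * (Matrix.of fun a b => X (i, a) (j, b))).trace = _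
    conv_lhs => rw [← hP2, mul_assoc, Matrix.trace_mul_comm, Matrix.trace]
    rw [Matrix.sum_apply]
    refine Finset.sum_congr rfl fun c _ => ?_
    have hc : ∀ x, P c x = star (P x c) := fun x => (hP.apply c x).symm
    simp only [Matrix.diag, Matrix.mul_apply, Matrix.conjTranspose_apply, Matrix.of_apply,
      Fintype.sum_prod_type, apply_ite star, star_zero, ite_mul, zero_mul, mul_ite, mul_zero,
      Finset.sum_ite_irrel, Finset.sum_const_zero, Finset.sum_ite_eq', Finset.mem_univ, if_true, hc]
  rw [h1]
  exact (Matrix.posSemidef_sum _ fun c _ => hX.conjTranspose_mul_mul_same _).kronecker hQ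

omit [DecidableEq m] in
lemma isChannel_measPrep_add {P : Matrix n n ℂ} {r r' : ℝ} (h : IsBlockProj P r r')
    {Q Q' : Matrix m m ℂ} (hQ : IsDensity Q) (hQ' : IsDensity Q') :
    IsChannel (measPrep P Q + measPrep (1 - P) Q') := by
  constructor
  · intro s X hX
    have : ampliation (measPrep P Q + measPrep (1 - P) Q') s X =
      ampliation (measPrep P Q) s X + ampliation (measPrep (1 - P) Q') s X := rfl
    rw [this]
    exact (ampliation_measPrep_posSemidef h.herm h.idem hQ.1 s X hX).add
      (ampliation_measPrep_posSemidef h.compl.herm h.compl.idem hQ'.1 s X hX)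
  · intro X
    have : (measPrep P Q + measPrep (1 - P) Q' : Matrix n n ℂ →ₗ[ℂ] Matrix m m ℂ) X =
      (P * X).trace • Q + ((1 - P) * X).trace • Q' := rfl
    rw [this, Matrix.trace_add, Matrix.trace_smul, Matrix.trace_smul, hQ.2, hQ'.2, smul_eq_mul,
      smul_eq_mul, mul_one, mul_one, ← Matrix.trace_add, ← add_mul]
    simp

omit [Fintype m] in
lemma measPrep_apply_eq_blockState {P : Matrix n n ℂ} {R : Matrix m m ℂ} {s s' : ℝ}
    {σ : Matrix n n ℂ} {q : ℝ} (hσ : σ.trace = 1) (hq : (P * σ).trace = q) :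
    (measPrep P (s⁻¹ • R) + measPrep (1 - P) (s'⁻¹ • (1 - R)) :
      Matrix n n ℂ →ₗ[ℂ] Matrix m m ℂ) σ = blockState R s s' q := by
  have : (measPrep P (s⁻¹ • R) + measPrep (1 - P) (s'⁻¹ • (1 - R)) :
      Matrix n n ℂ →ₗ[ℂ] Matrix m m ℂ) σ =
      (P * σ).trace • (s⁻¹ • R) + ((1 - P) * σ).trace • (s'⁻¹ • (1 - R)) := rfl
  have h2 : ((1 - P) * σ).trace = ((1 - q : ℝ) : ℂ) := by
    rw [sub_mul, Matrix.trace_sub, one_mul, hσ, hq]; simp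
  rw [this, h2, hq, blockState]
  ext i j
  simp [div_eq_mul_inv, mul_assoc]

lemma IsBlockProj.isDensity {P : Matrix n n ℂ} {r r' : ℝ} (h : IsBlockProj P r r') :
    IsDensity (r⁻¹ • P) := by
  refine ⟨h.posSemidef.smul (inv_nonneg.2 h.pos.le), ?_⟩
  rw [Matrix.trace_smul, h.trace, Complex.real_smul, ← Complex.ofReal_mul,
    inv_mul_cancel₀ h.pos.ne', Complex.ofReal_one]

/-- Measuring the blocks of one projection and preparing those of another does not increase a
generalized divergence. -/
lemma blockState_le_of_isGeneralizedDivergence {D : DivergenceFamily}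
    (hD : IsGeneralizedDivergence D) {P : Matrix n n ℂ} {r r' : ℝ} (h : IsBlockProj P r r')
    {R : Matrix m m ℂ} {s s' : ℝ} (h' : IsBlockProj R s s') {p q : ℝ} (hp : p ∈ Set.Icc (0 : ℝ) 1)
    {σ : Matrix n n ℂ} (hσ : IsDensity σ) (hq : (P * σ).trace = q) :
    D m (blockState R s s' p) (blockState R s s' q) ≤ D n (blockState P r r' p) σ := by
  have hN := isChannel_measPrep_add h h'.isDensity h'.compl.isDensity
  have := hD n m _ _ _ hN (h.isDensity_blockState hp) hσ
  rwa [measPrep_apply_eq_blockState (h.isDensity_blockState hp).2 (h.trace_mul_blockState p),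
    measPrep_apply_eq_blockState hσ.2 hq] at this

omit [DecidableEq n] in
lemma trace_mul_eq_ofReal {P σ : Matrix n n ℂ} (hP : P.IsHermitian) (hσ : σ.IsHermitian) :
    (P * σ).trace = ((P * σ).trace.re : ℂ) := by
  refine (Complex.conj_eq_iff_re.1 ?_).symm
  have : star (P * σ).trace = ((P * σ)ᴴ).trace := (Matrix.trace_conjTranspose _).symm
  rw [Matrix.conjTranspose_mul, hP.eq, hσ.eq, Matrix.trace_mul_comm σ P] at this
  exact this

lemma IsBlockProj.trace_mul_re_mem {P : Matrix n n ℂ} {r r' : ℝ} (h : IsBlockProj P r r')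
    {σ : Matrix n n ℂ} (hσ : IsDensity σ) : (P * σ).trace.re ∈ Set.Icc (0 : ℝ) 1 := by
  refine ⟨trace_mul_re_nonneg hσ.1 h.posSemidef, ?_⟩
  have := trace_mul_re_nonneg hσ.1 h.compl.posSemidef
  rw [sub_mul, Matrix.trace_sub, one_mul, hσ.2] at this
  simpa using this

/-- The unextendible-type infimum over a set of states that is described by one threshold. -/
lemma iInf_generalizedDivergence {D : DivergenceFamily}
    (hD : IsGeneralizedDivergence D) {P : Matrix n n ℂ} {r r' : ℝ} (h : IsBlockProj P r r')
    {S : Set (Matrix n n ℂ)} {τ : ℝ} (hS : ∀ σ ∈ S, IsDensity σ ∧ (P * σ).trace.re ≤ τ)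
    (hS' : ∀ q ∈ Set.Icc (0 : ℝ) (min 1 τ), blockState P r r' q ∈ S)
    {p : ℝ} (hp : p ∈ Set.Icc (0 : ℝ) 1) :
    ⨅ σ ∈ S, D n (blockState P r r' p) σ =
      ⨅ q ∈ Set.Icc (0 : ℝ) (min 1 τ), binaryDiv D p q := by
  apply le_antisymm
  · refine le_iInf₂ fun q hq => iInf₂_le_of_le _ (hS' q hq) ?_
    rw [binaryDiv, kappa_eq_blockState, kappa_eq_blockState]
    have hq1 : q ∈ Set.Icc (0 : ℝ) 1 := ⟨hq.1, hq.2.trans (min_le_left _ _)⟩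
    -- Upper bound: the channel goes from the two-level states to the blocks of `P`.
    exact blockState_le_of_isGeneralizedDivergence hD isBlockProj_kappaProj h hp
      (isBlockProj_kappaProj.isDensity_blockState hq1)
      (isBlockProj_kappaProj.trace_mul_blockState q)
  · refine le_iInf₂ fun σ hσ => ?_
    obtain ⟨h1, h2⟩ := hS σ hσ
    have h3 := h.trace_mul_re_mem h1
    refine iInf₂_le_of_le _ ⟨h3.1, le_min h3.2 h2⟩ ?_
    rw [binaryDiv, kappa_eq_blockState, kappa_eq_blockState]
    -- Lower bound: the channel goes from the blocks of `P` to the two-level states, with `q = Tr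
    -- Pσ`.
    exact blockState_le_of_isGeneralizedDivergence hD h isBlockProj_kappaProj hp h1
      (trace_mul_eq_ofReal h.herm h1.1.isHermitian)

end Channels

/-! ### Binary quantities -/

/-- The binary relative entropy. -/
def binRel (p q : ℝ) : ℝ :=
  p * Real.logb 2 (p / q) + (1 - p) * Real.logb 2 ((1 - p) / (1 - q))

/-- The binary Rényi quantity. -/
def binQ (α p q : ℝ) : ℝ := p ^ α * q ^ (1 - α) + (1 - p) ^ α * (1 - q) ^ (1 - α)

/-- The position of `q` relative to `p` and a reference point `w ≤ p`. -/
structure Comparable (p w q : ℝ) : Prop where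
  nonneg : 0 ≤ w
  le : w ≤ p
  le_one : p ≤ 1
  q_nonneg : 0 ≤ q
  q_le_one : q ≤ 1
  below : q ≤ w ∨ w = p
  pos : p ≠ 0 → 0 < w

namespace Comparable

variable {p w q : ℝ}

lemma p_nonneg (h : Comparable p w q) : 0 ≤ p := h.nonneg.trans h.le

lemma pos' (h : Comparable p w q) (hp : 1 - p ≠ 0) : 0 < 1 - w := by
  have h1 : p < 1 := lt_of_le_of_ne h.le_one fun h' => hp (by linarith)
  linarith [h.le]

/-- This is the sign of the correction left by the tangent lines. As `w ≤ p`, the first power is at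
least `1` and the second at most `1`, so `q ≤ w` suffices; if `w = p` lies inside the interval, the
two powers are equal. -/
lemma mul_sub_rpow_nonpos (h : Comparable p w q) {α : ℝ} (hα : 0 < α) :
    (q - w) * ((p / w) ^ α - ((1 - p) / (1 - w)) ^ α) ≤ 0 := by
  have h1 := h.nonneg
  have h2 := h.le
  have h3 := h.le_one
  have h4 : ((1 - p) / (1 - w)) ^ α ≤ 1 :=
    Real.rpow_le_one (div_nonneg (by linarith) (by linarith))
      (div_le_one_of_le₀ (by linarith) (by linarith)) hα.le
  -- `w = 0` forces `p = 0`; the quotient `0 / 0` counts as `0` and the claim becomes `-q ≤ 0`.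
  rcases h1.eq_or_lt with h0 | h0
  · have hp : p = 0 := by
      by_contra hp
      exact (h.pos hp).ne h0
    subst hp
    rw [← h0]
    have := h.q_nonneg
    simp [Real.zero_rpow hα.ne', this]
  · have h5 : 1 ≤ (p / w) ^ α := Real.one_le_rpow ((one_le_div h0).2 h2) hα.le
    rcases h.below with hq | hq
    · exact mul_nonpos_of_nonpos_of_nonneg (by linarith) (by linarith)
    · subst hq
      rcases h3.eq_or_lt with hw | hw
      · exact mul_nonpos_of_nonpos_of_nonneg (by linarith [h.q_le_one]) (by linarith)
      · rw [div_self h0.ne', div_self (by linarith)]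
        simp

lemma binQ_pos (h : Comparable p w q) (α : ℝ) : 0 < binQ α p w := by
  have hw : 0 ≤ 1 - w := by linarith [h.le, h.le_one]
  have hp : 0 ≤ 1 - p := by linarith [h.le_one]
  by_cases h0 : p = 0
  · have h1 : 0 < 1 - w := h.pos' (by simp [h0])
    exact add_pos_of_nonneg_of_pos
      (mul_nonneg (Real.rpow_nonneg h.p_nonneg _) (Real.rpow_nonneg h.nonneg _))
      (mul_pos (Real.rpow_pos_of_pos (by rw [h0]; norm_num) _) (Real.rpow_pos_of_pos h1 _))
  · exact add_pos_of_pos_of_nonneg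
      (mul_pos (Real.rpow_pos_of_pos (lt_of_le_of_ne h.p_nonneg (Ne.symm h0)) _)
        (Real.rpow_pos_of_pos (h.pos h0) _))
      (mul_nonneg (Real.rpow_nonneg hp _) (Real.rpow_nonneg hw _))

end Comparable

lemma binQ_self {α p : ℝ} (hα : 0 < α) (hp : p ∈ Set.Icc (0 : ℝ) 1) : binQ α p p = 1 := by
  have key : ∀ x : ℝ, 0 ≤ x → x ^ α * x ^ (1 - α) = x := by
    intro x hx
    rcases hx.eq_or_lt with rfl | hx
    · simp [Real.zero_rpow hα.ne']
    · rw [← Real.rpow_add hx]; simp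
  rw [binQ, key p hp.1, key (1 - p) (by linarith [hp.2])]
  ring

lemma binRel_self (p : ℝ) : binRel p p = 0 := by
  have key : ∀ x : ℝ, x * Real.logb 2 (x / x) = 0 := by
    intro x
    by_cases hx : x = 0
    · simp [hx]
    · simp [div_self hx]
  rw [binRel, key, key, add_zero]

/-- With `x = Tr Pσ - w`, the second factor on the left is the tangent line of `x ↦ x^(1-α)` at
`w/r`, traced against `P`. The powers of `r` cancel, so the bound no longer sees the rank. -/
lemma block_rpow_identity {α p r w : ℝ} (x : ℝ) (hp : 0 ≤ p) (hr : 0 < r) (hw : 0 < w) :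
    (p / r) ^ α * ((w / r) ^ (1 - α) * r + (1 - α) * (w / r) ^ (-α) * x) =
      p ^ α * w ^ (1 - α) + (1 - α) * (p / w) ^ α * x := by
  have h1 := (Real.rpow_pos_of_pos hr α).ne'
  have h2 := (Real.rpow_pos_of_pos hw α).ne'
  rw [Real.div_rpow hp hr.le, Real.div_rpow hp hw.le, Real.div_rpow hw.le hr.le,
    Real.div_rpow hw.le hr.le, Real.rpow_sub hw, Real.rpow_sub hr, Real.rpow_neg hw.le,
    Real.rpow_neg hr.le, Real.rpow_one, Real.rpow_one]
  field_simp

section Blocks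

variable {n : Type} [Fintype n] [DecidableEq n] {P : Matrix n n ℂ} {r r' : ℝ}

lemma trace_blockState_mul (P : Matrix n n ℂ) (r r' p : ℝ) (M : Matrix n n ℂ) :
    (blockState P r r' p * M).trace.re =
      p / r * (P * M).trace.re + (1 - p) / r' * ((1 - P) * M).trace.re := by
  rw [blockState, add_mul, smul_mul_assoc, smul_mul_assoc, Matrix.trace_add, Matrix.trace_smul,
    Matrix.trace_smul]
  simp

lemma rpowOp_blockState (h : IsBlockProj P r r') (p s : ℝ) :
    rpowOp (blockState P r r' p) s =
      ((p / r) ^ s) • P + (((1 - p) / r') ^ s) • (1 - P) := h.cfc_block _ _ _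

lemma log2Op_blockState (h : IsBlockProj P r r') (p : ℝ) :
    log2Op (blockState P r r' p) =
      (Real.logb 2 (p / r)) • P + (Real.logb 2 ((1 - p) / r')) • (1 - P) := h.cfc_block _ _ _

lemma trace_mul_compl {σ : Matrix n n ℂ} (hσ : IsDensity σ) (P : Matrix n n ℂ) :
    ((1 - P) * σ).trace.re = 1 - (P * σ).trace.re := by
  rw [sub_mul, Matrix.trace_sub, one_mul, hσ.2]
  simp

/-! ### Lower bounds for one block -/

/-- The logarithm lies below its tangent line at `w/r`, and `Tr P = r`. The support inclusion is
needed since `log 0 = 0` by default. -/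
lemma block_log_bound (h : IsBlockProj P r r') {σ : Matrix n n ℂ} (hσ : IsDensity σ) {p w : ℝ}
    (hw : p ≠ 0 → 0 < w) (hp : 0 ≤ p) (hs : SuppLE (blockState P r r' p) σ) :
    p / r * (P * log2Op σ).trace.re ≤
      p * Real.logb 2 (w / r) + p / w * ((P * σ).trace.re - w) / Real.log 2 := by
  by_cases h0 : p = 0
  · simp [h0]
  have hw := hw h0
  have hl : 0 < Real.log 2 := Real.log_pos one_lt_two
  have hr := h.pos
  have hy : 0 < w / r := div_pos hw h.pos
  have hP := h.suppLE_of_blockState h0 hs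
  have key := trace_mul_cfc_le_affine hσ.1 h.posSemidef (f := fun x : ℝ => Real.logb 2 x)
    (a := Real.logb 2 (w / r) - 1 / Real.log 2) (b := 1 / (w / r) / Real.log 2) (by
      intro x hx hne
      have := log_le_tangent (lt_of_le_of_ne hx (Ne.symm (hne hP))) hy
      have e : Real.logb 2 (w / r) - 1 / Real.log 2 + 1 / (w / r) / Real.log 2 * x =
          (Real.log (w / r) + 1 / (w / r) * (x - w / r)) / Real.log 2 := by
        simp only [Real.logb]
        field_simp
        ring
      rw [e]
      exact div_le_div_of_nonneg_right this hl.le)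
  rw [h.trace_re] at key
  calc _ ≤ p / r * ((Real.logb 2 (w / r) - 1 / Real.log 2) * r +
        1 / (w / r) / Real.log 2 * (P * σ).trace.re) :=
        mul_le_mul_of_nonneg_left key (div_nonneg hp h.pos.le)
    _ = _ := by
        field_simp
        ring

/-- The exponent `1 - α` is negative, so the power is convex and lies above its tangent line at
`w/r`; the point `0` is excluded by the support inclusion. -/
lemma block_petz_bound_of_one_lt (h : IsBlockProj P r r') {σ : Matrix n n ℂ} (hσ : IsDensity σ)
    {α p w : ℝ} (hα : 1 < α) (hw : p ≠ 0 → 0 < w) (hp : 0 ≤ p)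
    (hs : SuppLE (blockState P r r' p) σ) :
    p ^ α * w ^ (1 - α) + (1 - α) * (p / w) ^ α * ((P * σ).trace.re - w) ≤
      (p / r) ^ α * (P * rpowOp σ (1 - α)).trace.re := by
  by_cases h0 : p = 0
  · simp [h0, Real.zero_rpow (by linarith : α ≠ 0)]
  have hw := hw h0
  have hy : 0 < w / r := div_pos hw h.pos
  have hP := h.suppLE_of_blockState h0 hs
  rw [← block_rpow_identity _ hp h.pos hw]
  refine mul_le_mul_of_nonneg_left ?_ (Real.rpow_nonneg (div_nonneg hp h.pos.le) _)
  have key := affine_le_trace_mul_cfc hσ.1 h.posSemidef (f := fun x : ℝ => x ^ (1 - α))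
    (a := (w / r) ^ (1 - α) - (1 - α) * (w / r) ^ (1 - α - 1) * (w / r))
    (b := (1 - α) * (w / r) ^ (1 - α - 1)) (by
      intro x hx hne
      have := rpow_tangent_le hx hy (β := 1 - α) (Or.inl ⟨by linarith, hne hP⟩)
      linarith)
  rw [h.trace_re] at key
  refine le_trans (le_of_eq ?_) key
  rw [show 1 - α - 1 = -α by ring]
  have := h.pos
  field_simp
  ring

/-- Now `1 - α` lies in `(0, 1)`: the power is concave, the inequality turns around, and the point
`0` is harmless. -/
lemma block_petz_bound_of_lt_one (h : IsBlockProj P r r') {σ : Matrix n n ℂ} (hσ : IsDensity σ)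
    {α p w : ℝ} (hα0 : 0 < α) (hα : α < 1) (hw : p ≠ 0 → 0 < w) (hp : 0 ≤ p) :
    (p / r) ^ α * (P * rpowOp σ (1 - α)).trace.re ≤
      p ^ α * w ^ (1 - α) + (1 - α) * (p / w) ^ α * ((P * σ).trace.re - w) := by
  by_cases h0 : p = 0
  · simp [h0, Real.zero_rpow hα0.ne']
  have hw := hw h0
  have hy : 0 < w / r := div_pos hw h.pos
  rw [← block_rpow_identity _ hp h.pos hw]
  refine mul_le_mul_of_nonneg_left ?_ (Real.rpow_nonneg (div_nonneg hp h.pos.le) _)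
  have key := trace_mul_cfc_le_affine hσ.1 h.posSemidef (f := fun x : ℝ => x ^ (1 - α))
    (a := (w / r) ^ (1 - α) - (1 - α) * (w / r) ^ (1 - α - 1) * (w / r))
    (b := (1 - α) * (w / r) ^ (1 - α - 1)) (by
      intro x hx _
      have := rpow_le_tangent hx hy (β := 1 - α) (by linarith) (by linarith)
      linarith)
  rw [h.trace_re] at key
  refine le_trans key (le_of_eq ?_)
  rw [show 1 - α - 1 = -α by ring]
  have := h.pos
  field_simp
  ring

/-- A chain rule: linearizing `y ↦ y^((1-α)/α)` and then `z ↦ z^α` gives the tangent of `a^α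
y^(1-α)`. The sandwiched bounds therefore end in the same expression as the Petz bounds. -/
lemma sandwiched_identity {α a y : ℝ} (r x : ℝ) (hα : 0 < α) (ha : 0 < a) (hy : 0 < y) :
    (a * y ^ ((1 - α) / α)) ^ α * r + α * (a * y ^ ((1 - α) / α)) ^ (α - 1) *
        (a * ((1 - α) / α * y ^ ((1 - α) / α - 1) * x)) =
      a ^ α * (y ^ (1 - α) * r + (1 - α) * y ^ (-α) * x) := by
  have e1 : (a * y ^ ((1 - α) / α)) ^ α = a ^ α * y ^ (1 - α) := by
    rw [Real.mul_rpow ha.le (Real.rpow_nonneg hy.le _), ← Real.rpow_mul hy.le,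
      div_mul_cancel₀ _ hα.ne']
  have e2 : (a * y ^ ((1 - α) / α)) ^ (α - 1) * (a * y ^ ((1 - α) / α - 1)) =
      a ^ α * y ^ (-α) := by
    rw [Real.mul_rpow ha.le (Real.rpow_nonneg hy.le _), ← Real.rpow_mul hy.le]
    have e3 : a ^ α = a ^ (α - 1) * a := by
      rw [Real.rpow_sub_one ha.ne', div_mul_cancel₀ _ ha.ne']
    have e4 : y ^ (-α) = y ^ ((1 - α) / α * (α - 1)) * y ^ ((1 - α) / α - 1) := by
      rw [← Real.rpow_add hy]
      congr 1
      field_simp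
      ring
    rw [e3, e4]
    ring
  rw [e1]
  have : α * (a * y ^ ((1 - α) / α)) ^ (α - 1) *
      (a * ((1 - α) / α * y ^ ((1 - α) / α - 1) * x)) =
      (α * ((1 - α) / α)) * ((a * y ^ ((1 - α) / α)) ^ (α - 1) *
        (a * y ^ ((1 - α) / α - 1))) * x := by ring
  rw [this, e2, mul_div_cancel₀ _ hα.ne']
  ring

/-- Two tangent lines are nested: for `x^((1-α)/α)` at `w/r` on the spectrum of `σ`, and for `x^α`
on the spectrum of `Y`. Both powers are convex, and the outer slope is nonnegative. -/
lemma block_sandwiched_bound_of_one_lt (h : IsBlockProj P r r') {σ Y : Matrix n n ℂ}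
    (hσ : IsDensity σ) (hY : Y.PosSemidef) {α p w : ℝ} (hα : 1 < α) (hw : p ≠ 0 → 0 < w)
    (hp : 0 ≤ p) (hs : SuppLE (blockState P r r' p) σ)
    (hPY : (P * Y).trace.re = p / r * (P * rpowOp σ ((1 - α) / α)).trace.re) :
    p ^ α * w ^ (1 - α) + (1 - α) * (p / w) ^ α * ((P * σ).trace.re - w) ≤
      (P * rpowOp Y α).trace.re := by
  have hα0 : 0 < α := by linarith
  by_cases h0 : p = 0
  · simpa [h0, Real.zero_rpow (by linarith : α ≠ 0), rpowOp] using
      trace_mul_cfc_nonneg hY h.posSemidef fun x hx => Real.rpow_nonneg hx α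
  have hw := hw h0
  have hr := h.pos
  have hy : 0 < w / r := div_pos hw h.pos
  have ha : 0 < p / r := div_pos (lt_of_le_of_ne hp (Ne.symm h0)) h.pos
  have hP := h.suppLE_of_blockState h0 hs
  have hβ : (1 - α) / α ≤ 0 := div_nonpos_of_nonpos_of_nonneg (by linarith) hα0.le
  rw [← block_rpow_identity _ hp h.pos hw, ← sandwiched_identity _ _ hα0 ha hy]
  set β := (1 - α) / α with hβ'
  -- This is the eigenvalue that `Y` would have on the block if `σ` were the block state of weight
  -- `w`.
  have hz : 0 < p / r * (w / r) ^ β := mul_pos ha (Real.rpow_pos_of_pos hy _)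
  set z := p / r * (w / r) ^ β with hz'
  have k1 := affine_le_trace_mul_cfc hσ.1 h.posSemidef (f := fun x : ℝ => x ^ β)
    (a := (w / r) ^ β - β * (w / r) ^ (β - 1) * (w / r)) (b := β * (w / r) ^ (β - 1)) (by
      intro x hx hne
      have := rpow_tangent_le hx hy (β := β) (Or.inl ⟨hβ, hne hP⟩)
      linarith)
  have k2 := affine_le_trace_mul_cfc hY h.posSemidef (f := fun x : ℝ => x ^ α)
    (a := z ^ α - α * z ^ (α - 1) * z) (b := α * z ^ (α - 1)) (by
      intro x hx hne
      have := rpow_tangent_le hx hz (β := α) (Or.inr hα.le)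
      linarith)
  rw [h.trace_re] at k1 k2
  have k3 : z * r + p / r * (β * (w / r) ^ (β - 1) * ((P * σ).trace.re - w)) ≤
      (P * Y).trace.re := by
    rw [hPY, hz']
    refine le_trans (le_of_eq ?_) (mul_le_mul_of_nonneg_left k1 ha.le)
    field_simp
    ring
  have k4 : 0 ≤ α * z ^ (α - 1) := mul_nonneg hα0.le (Real.rpow_nonneg hz.le _)
  have k5 := mul_le_mul_of_nonneg_left k3 k4
  refine le_trans ?_ k2
  linarith

/-- The same nesting with two concave powers; `α ≥ 1/2` is what makes `(1-α)/α ≤ 1`. -/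
lemma block_sandwiched_bound_of_lt_one (h : IsBlockProj P r r') {σ Y : Matrix n n ℂ}
    (hσ : IsDensity σ) (hY : Y.PosSemidef) {α p w : ℝ} (hα2 : 1 / 2 ≤ α) (hα : α < 1)
    (hw : p ≠ 0 → 0 < w) (hp : 0 ≤ p)
    (hPY : (P * Y).trace.re = p / r * (P * rpowOp σ ((1 - α) / α)).trace.re) :
    (P * rpowOp Y α).trace.re ≤
      p ^ α * w ^ (1 - α) + (1 - α) * (p / w) ^ α * ((P * σ).trace.re - w) := by
  have hα0 : 0 < α := by linarith
  by_cases h0 : p = 0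
  · have := trace_mul_cfc_eq_zero hY h.posSemidef (f := fun x : ℝ => x ^ α)
      (Real.zero_rpow hα0.ne') (by rw [hPY, h0]; simp)
    rw [rpowOp, this]
    simp [h0, Real.zero_rpow hα0.ne']
  have hw := hw h0
  have hr := h.pos
  have hy : 0 < w / r := div_pos hw h.pos
  have ha : 0 < p / r := div_pos (lt_of_le_of_ne hp (Ne.symm h0)) h.pos
  have hβ : 0 ≤ (1 - α) / α := div_nonneg (by linarith) hα0.le
  have hβ1 : (1 - α) / α ≤ 1 := by
    rw [div_le_one hα0]
    linarith
  rw [← block_rpow_identity _ hp h.pos hw, ← sandwiched_identity _ _ hα0 ha hy]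
  set β := (1 - α) / α with hβ'
  have hz : 0 < p / r * (w / r) ^ β := mul_pos ha (Real.rpow_pos_of_pos hy _)
  set z := p / r * (w / r) ^ β with hz'
  have k1 := trace_mul_cfc_le_affine hσ.1 h.posSemidef (f := fun x : ℝ => x ^ β)
    (a := (w / r) ^ β - β * (w / r) ^ (β - 1) * (w / r)) (b := β * (w / r) ^ (β - 1)) (by
      intro x hx _
      have := rpow_le_tangent hx hy (β := β) hβ hβ1
      linarith)
  have k2 := trace_mul_cfc_le_affine hY h.posSemidef (f := fun x : ℝ => x ^ α)
    (a := z ^ α - α * z ^ (α - 1) * z) (b := α * z ^ (α - 1)) (by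
      intro x hx _
      have := rpow_le_tangent hx hz (β := α) hα0.le hα.le
      linarith)
  rw [h.trace_re] at k1 k2
  have k3 : (P * Y).trace.re ≤
      z * r + p / r * (β * (w / r) ^ (β - 1) * ((P * σ).trace.re - w)) := by
    rw [hPY, hz']
    refine le_trans (mul_le_mul_of_nonneg_left k1 ha.le) (le_of_eq ?_)
    field_simp
    ring
  have k4 : 0 ≤ α * z ^ (α - 1) := mul_nonneg hα0.le (Real.rpow_nonneg hz.le _)
  have k5 := mul_le_mul_of_nonneg_left k3 k4
  refine le_trans k2 ?_
  linarith

end Blocks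

/-! ### Divergences that are determined by a binary quantity on block states -/

/-- `D` is given by the real function `b` on pairs of block states, and is bounded below by `b`
when the second state is arbitrary. -/
structure HasBinaryForm (D : DivergenceFamily) (b : ℝ → ℝ → ℝ) : Prop where
  lower : ∀ {n : Type} [Fintype n] [DecidableEq n] {P : Matrix n n ℂ} {r r' p w : ℝ}
    {σ : Matrix n n ℂ}, IsBlockProj P r r' → IsDensity σ → Comparable p w (P * σ).trace.re →
    (b p w : EReal) ≤ D n (blockState P r r' p) σ
  eq : ∀ {n : Type} [Fintype n] [DecidableEq n] {P : Matrix n n ℂ} {r r' p q : ℝ},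
    IsBlockProj P r r' → p ∈ Set.Icc (0 : ℝ) 1 → q ∈ Set.Ioo (0 : ℝ) 1 →
    D n (blockState P r r' p) (blockState P r r' q) = b p q
  self : ∀ {n : Type} [Fintype n] [DecidableEq n] {ρ : Matrix n n ℂ}, IsDensity ρ → D n ρ ρ = 0
  self' : ∀ {p : ℝ}, p ∈ Set.Icc (0 : ℝ) 1 → b p p = 0

lemma HasBinaryForm.binaryDiv_eq {D : DivergenceFamily} {b : ℝ → ℝ → ℝ} (hD : HasBinaryForm D b)
    {p q : ℝ} (hp : p ∈ Set.Icc (0 : ℝ) 1) (hq : q ∈ Set.Ioo (0 : ℝ) 1) :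
    binaryDiv D p q = b p q := by
  rw [binaryDiv, kappa_eq_blockState, kappa_eq_blockState]
  exact hD.eq isBlockProj_kappaProj hp hq

/-- Below the threshold the state itself belongs to `S`, and the reference point `w = p` gives the
lower bound `b p p = 0`. Above it, the block state of weight `τ` is optimal, by the reference point
`w = τ`. Monotonicity of `D` plays no role. -/
lemma HasBinaryForm.iInf_eq_closedForm {D : DivergenceFamily} {b : ℝ → ℝ → ℝ}
    (hD : HasBinaryForm D b) {n : Type} [Fintype n] [DecidableEq n] {P : Matrix n n ℂ}
    {r r' : ℝ} (h : IsBlockProj P r r')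
    {S : Set (Matrix n n ℂ)} {τ : ℝ} (hτ : 0 < τ)
    (hS : ∀ σ ∈ S, IsDensity σ ∧ (P * σ).trace.re ≤ τ)
    (hS' : ∀ q ∈ Set.Icc (0 : ℝ) (min 1 τ), blockState P r r' q ∈ S)
    {p : ℝ} (hp : p ∈ Set.Icc (0 : ℝ) 1) :
    ⨅ σ ∈ S, D n (blockState P r r' p) σ = closedForm D τ p := by
  by_cases hpτ : p ≤ τ
  · rw [closedForm, if_pos hpτ]
    apply le_antisymm
    · refine iInf₂_le_of_le _ (hS' p ⟨hp.1, le_min hp.2 hpτ⟩) ?_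
      rw [hD.self (h.isDensity_blockState hp)]
    · refine le_iInf₂ fun σ hσ => ?_
      have h1 := (hS σ hσ).1
      have h3 := h.trace_mul_re_mem h1
      have := hD.lower (p := p) (w := p) h h1
        ⟨hp.1, le_rfl, hp.2, h3.1, h3.2, Or.inr rfl, fun h0 => lt_of_le_of_ne hp.1 (Ne.symm h0)⟩
      rwa [hD.self' hp, EReal.coe_zero] at this
  · rw [closedForm, if_neg hpτ]
    rw [not_le] at hpτ
    have hτ1 : τ < 1 := hpτ.trans_le hp.2
    rw [hD.binaryDiv_eq hp ⟨hτ, hτ1⟩]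
    apply le_antisymm
    · refine iInf₂_le_of_le _ (hS' τ ⟨hτ.le, le_min hτ1.le le_rfl⟩) ?_
      rw [hD.eq h hp ⟨hτ, hτ1⟩]
    · refine le_iInf₂ fun σ hσ => ?_
      obtain ⟨h1, h2⟩ := hS σ hσ
      have h3 := h.trace_mul_re_mem h1
      exact hD.lower h h1 ⟨hτ.le, hpτ.le, hp.2, h3.1, h3.2, Or.inl h2, fun _ => hτ⟩

section Instances

variable {n : Type} [Fintype n] [DecidableEq n] {P : Matrix n n ℂ} {r r' : ℝ}

omit [DecidableEq n] in
lemma suppLE_refl (ρ : Matrix n n ℂ) : SuppLE ρ ρ := fun _ hv => hv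

/-! ### The relative entropy -/

lemma trace_blockState_mul_log2Op_self (h : IsBlockProj P r r') (p : ℝ) :
    (blockState P r r' p * log2Op (blockState P r r' p)).trace.re =
      p * Real.logb 2 (p / r) + (1 - p) * Real.logb 2 ((1 - p) / r') := by
  have hr := h.pos.ne'
  have hr' := h.pos'.ne'
  rw [log2Op_blockState h, blockState, h.block_mul, h.trace_block]
  field_simp

lemma mul_logb_div_sub {p r w : ℝ} (hr : 0 < r) (hw : p ≠ 0 → 0 < w) :
    p * Real.logb 2 (p / r) - p * Real.logb 2 (w / r) = p * Real.logb 2 (p / w) := by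
  by_cases h0 : p = 0
  · simp [h0]
  have hw := hw h0
  rw [Real.logb_div h0 hr.ne', Real.logb_div hw.ne' hr.ne', Real.logb_div h0 hw.ne']
  ring

lemma relEntropy_lower (h : IsBlockProj P r r') {σ : Matrix n n ℂ} (hσ : IsDensity σ) {p w : ℝ}
    (hc : Comparable p w (P * σ).trace.re) :
    (binRel p w : EReal) ≤ relEntropy n (blockState P r r' p) σ := by
  rw [relEntropy]
  split_ifs with hs
  · rw [EReal.coe_le_coe_iff, mul_sub, Matrix.trace_sub, Complex.sub_re,
      trace_blockState_mul_log2Op_self h, trace_blockState_mul, binRel]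
    have hp1 : 0 ≤ 1 - p := by linarith [hc.le_one]
    have b1 := block_log_bound h hσ hc.pos hc.p_nonneg hs
    rw [← IsBlockProj.blockState_compl] at hs
    have b2 := block_log_bound h.compl hσ hc.pos' hp1 hs
    have e1 := mul_logb_div_sub h.pos hc.pos
    have e2 := mul_logb_div_sub h.pos' hc.pos'
    rw [trace_mul_compl hσ] at b2
    -- The correction for the logarithm is the one for powers at exponent `1`.
    have b3 := hc.mul_sub_rpow_nonpos one_pos
    rw [Real.rpow_one, Real.rpow_one] at b3
    have b4 := div_nonpos_of_nonpos_of_nonneg b3 (Real.log_pos one_lt_two).le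
    have e3 : ((P * σ).trace.re - w) * (p / w - (1 - p) / (1 - w)) / Real.log 2 =
      p / w * ((P * σ).trace.re - w) / Real.log 2 +
      (1 - p) / (1 - w) * (1 - (P * σ).trace.re - (1 - w)) / Real.log 2 := by ring
    linarith
  · exact le_top

lemma relEntropy_blockState (h : IsBlockProj P r r') (p : ℝ) {q : ℝ}
    (hq : q ∈ Set.Ioo (0 : ℝ) 1) :
    relEntropy n (blockState P r r' p) (blockState P r r' q) = (binRel p q : ℝ) := by
  have hr := h.pos.ne'
  have hr' := h.pos'.ne'
  rw [relEntropy, if_pos (h.suppLE_blockState _ hq.1 hq.2), mul_sub, Matrix.trace_sub,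
    Complex.sub_re, trace_blockState_mul_log2Op_self h, log2Op_blockState h q, blockState,
    h.block_mul, h.trace_block, binRel, ← mul_logb_div_sub h.pos fun _ => hq.1,
    ← mul_logb_div_sub h.pos' fun _ => sub_pos.2 hq.2]
  congr 1
  have e : ∀ x t L : ℝ, t ≠ 0 → x / t * L * t = x * L := by
    intro x t L ht
    field_simp
  rw [e _ _ _ hr, e _ _ _ hr']
  ring

lemma hasBinaryForm_relEntropy : HasBinaryForm relEntropy binRel where
  lower := fun h hσ hc => relEntropy_lower h hσ hc
  eq := fun h _ hq => relEntropy_blockState h _ hq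
  self := fun _ => by
    rw [relEntropy, if_pos (suppLE_refl _)]
    simp
  self' := fun _ => binRel_self _

/-! ### The Rényi relative entropies -/

omit [DecidableEq n] in
-- The sign of `1/(α - 1)` decides the direction in which `B` and `Q` must compare; the cases with
-- value `⊤` are free.
lemma le_renyiOf {α : ℝ} (hα : α ≠ 1) {ρ σ : Matrix n n ℂ} {Q B : ℝ} (hB : 0 < B)
    (hQ : 0 ≤ Q) (h1 : 1 < α → SuppLE ρ σ → B ≤ Q) (h2 : α < 1 → Q ≤ B) :
    ((1 / (α - 1) * Real.logb 2 B : ℝ) : EReal) ≤ renyiOf α ρ σ Q := by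
  rw [renyiOf]
  split_ifs with h
  · exact le_top
  · rw [not_or, not_and, not_not] at h
    rw [EReal.coe_le_coe_iff]
    have hQ' : 0 < Q := lt_of_le_of_ne hQ (Ne.symm h.2)
    rcases lt_or_gt_of_ne hα with hlt | hgt
    · exact mul_le_mul_of_nonpos_left (Real.logb_le_logb_of_le one_lt_two hQ' (h2 hlt))
        (div_nonpos_of_nonneg_of_nonpos zero_le_one (by linarith))
    · exact mul_le_mul_of_nonneg_left
        (Real.logb_le_logb_of_le one_lt_two hB (h1 hgt (h.1 hgt)))
        (div_nonneg zero_le_one (by linarith))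

omit [DecidableEq n] in
lemma renyiOf_eq {α : ℝ} {ρ σ : Matrix n n ℂ} {Q : ℝ} (hs : SuppLE ρ σ) (hQ : Q ≠ 0) :
    renyiOf α ρ σ Q = ((1 / (α - 1) * Real.logb 2 Q : ℝ) : EReal) := by
  rw [renyiOf, if_neg]
  rintro (h | h)
  · exact h.2 hs
  · exact hQ h

lemma binQ_le_of_blocks {α p w q x y : ℝ} (hα : 1 < α) (hc : Comparable p w q)
    (hx : p ^ α * w ^ (1 - α) + (1 - α) * (p / w) ^ α * (q - w) ≤ x)
    (hy : (1 - p) ^ α * (1 - w) ^ (1 - α) +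
      (1 - α) * ((1 - p) / (1 - w)) ^ α * (1 - q - (1 - w)) ≤ y) : binQ α p w ≤ x + y := by
  have h1 := mul_nonneg_of_nonpos_of_nonpos (by linarith : 1 - α ≤ 0)
    (hc.mul_sub_rpow_nonpos (by linarith : 0 < α))
  rw [binQ]
  linarith

lemma le_binQ_of_blocks {α p w q x y : ℝ} (hα0 : 0 < α) (hα : α < 1) (hc : Comparable p w q)
    (hx : x ≤ p ^ α * w ^ (1 - α) + (1 - α) * (p / w) ^ α * (q - w))
    (hy : y ≤ (1 - p) ^ α * (1 - w) ^ (1 - α) +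
      (1 - α) * ((1 - p) / (1 - w)) ^ α * (1 - q - (1 - w))) : x + y ≤ binQ α p w := by
  have h1 := mul_nonpos_of_nonneg_of_nonpos (by linarith : 0 ≤ 1 - α)
    (hc.mul_sub_rpow_nonpos hα0)
  rw [binQ]
  linarith

lemma rpowOp_posSemidef {σ : Matrix n n ℂ} (hσ : σ.PosSemidef) (s : ℝ) :
    (rpowOp σ s).PosSemidef := by
  have h : rpowOp σ s = (rpowOp σ (s / 2))ᴴ * rpowOp σ (s / 2) := by
    have h2 : (rpowOp σ (s / 2))ᴴ = rpowOp σ (s / 2) := cfc_isHermitian _ _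
    rw [h2, rpowOp, rpowOp, ← cfc_mul _ _ σ (continuousOn_spectrum _ _)
      (continuousOn_spectrum _ _)]
    refine cfc_congr fun x hx => ?_
    have hx := spectrum_nonneg_of_posSemidef hσ hx
    by_cases hs : s = 0
    · simp [hs]
    rcases hx.eq_or_lt with rfl | hx
    · simp [Real.zero_rpow hs, Real.zero_rpow (div_ne_zero hs two_ne_zero)]
    · rw [← Real.rpow_add hx]
      simp
  rw [h]
  exact Matrix.posSemidef_conjTranspose_mul_self _

lemma trace_rpowOp_blockState_mul (h : IsBlockProj P r r') (p α : ℝ) (M : Matrix n n ℂ) :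
    (rpowOp (blockState P r r' p) α * M).trace.re =
      (p / r) ^ α * (P * M).trace.re + ((1 - p) / r') ^ α * ((1 - P) * M).trace.re := by
  rw [rpowOp_blockState h, add_mul, smul_mul_assoc, smul_mul_assoc, Matrix.trace_add,
    Matrix.trace_smul, Matrix.trace_smul]
  simp

lemma renyi_lower {α : ℝ} (hα0 : 0 < α) (hα : α ≠ 1) (h : IsBlockProj P r r')
    {σ : Matrix n n ℂ} (hσ : IsDensity σ) {p w : ℝ} (hc : Comparable p w (P * σ).trace.re) :
    ((1 / (α - 1) * Real.logb 2 (binQ α p w) : ℝ) : EReal) ≤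
      renyi α n (blockState P r r' p) σ := by
  have hp1 : 0 ≤ 1 - p := by linarith [hc.le_one]
  refine le_renyiOf hα (hc.binQ_pos α) ?_ ?_ ?_
  · exact trace_mul_re_nonneg (rpowOp_posSemidef hσ.1 _)
      (rpowOp_posSemidef (h.isDensity_blockState ⟨hc.p_nonneg, hc.le_one⟩).1 _)
  · intro h1 hs
    have b1 := block_petz_bound_of_one_lt h hσ h1 hc.pos hc.p_nonneg hs
    rw [← IsBlockProj.blockState_compl] at hs
    have b2 := block_petz_bound_of_one_lt h.compl hσ h1 hc.pos' hp1 hs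
    rw [trace_mul_compl hσ] at b2
    rw [trace_rpowOp_blockState_mul h]
    exact binQ_le_of_blocks h1 hc b1 b2
  · intro h1
    have b1 := block_petz_bound_of_lt_one h hσ hα0 h1 hc.pos hc.p_nonneg
    have b2 := block_petz_bound_of_lt_one h.compl hσ hα0 h1 hc.pos' hp1
    rw [trace_mul_compl hσ] at b2
    rw [trace_rpowOp_blockState_mul h]
    exact le_binQ_of_blocks hα0 h1 hc b1 b2

lemma div_rpow_mul_div_rpow {p q r α : ℝ} (hp : 0 ≤ p) (hq : 0 < q) (hr : 0 < r) :
    (p / r) ^ α * (q / r) ^ (1 - α) * r = p ^ α * q ^ (1 - α) := by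
  have h1 := (Real.rpow_pos_of_pos hr α).ne'
  rw [Real.div_rpow hp hr.le, Real.div_rpow hq.le hr.le, Real.rpow_sub hr, Real.rpow_one]
  field_simp

lemma binQ_pos {α p q : ℝ} (hp : p ∈ Set.Icc (0 : ℝ) 1) (hq : q ∈ Set.Ioo (0 : ℝ) 1) :
    0 < binQ α p q := by
  have hq1 : 0 < 1 - q := by linarith [hq.2]
  have hp1 : 0 ≤ 1 - p := by linarith [hp.2]
  have a1 := mul_nonneg (Real.rpow_nonneg hp.1 α) (Real.rpow_nonneg hq.1.le (1 - α))
  have a2 := mul_nonneg (Real.rpow_nonneg hp1 α) (Real.rpow_nonneg hq1.le (1 - α))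
  rcases hp.1.eq_or_lt with h0 | h0
  · exact add_pos_of_nonneg_of_pos a1
      (mul_pos (Real.rpow_pos_of_pos (by linarith) _) (Real.rpow_pos_of_pos hq1 _))
  · exact add_pos_of_pos_of_nonneg
      (mul_pos (Real.rpow_pos_of_pos h0 _) (Real.rpow_pos_of_pos hq.1 _)) a2

lemma renyi_blockState {α : ℝ} (h : IsBlockProj P r r') {p q : ℝ}
    (hp : p ∈ Set.Icc (0 : ℝ) 1) (hq : q ∈ Set.Ioo (0 : ℝ) 1) :
    renyi α n (blockState P r r' p) (blockState P r r' q) =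
      ((1 / (α - 1) * Real.logb 2 (binQ α p q) : ℝ) : EReal) := by
  have e : (rpowOp (blockState P r r' p) α * rpowOp (blockState P r r' q) (1 - α)).trace.re =
      binQ α p q := by
    rw [rpowOp_blockState h, rpowOp_blockState h, h.block_mul, h.trace_block,
      div_rpow_mul_div_rpow hp.1 hq.1 h.pos,
      div_rpow_mul_div_rpow (by linarith [hp.2]) (by linarith [hq.2]) h.pos', binQ]
  rw [renyi, e]
  exact renyiOf_eq (h.suppLE_blockState _ hq.1 hq.2) (binQ_pos hp hq).ne'

lemma rpow_mul_rpow_one_sub {α x : ℝ} (hα : 0 < α) (hx : 0 ≤ x) : x ^ α * x ^ (1 - α) = x := by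
  rcases hx.eq_or_lt with rfl | hx
  · simp [Real.zero_rpow hα.ne']
  · rw [← Real.rpow_add hx]; simp

omit [DecidableEq n] in
lemma renyiOf_self (α : ℝ) (ρ : Matrix n n ℂ) : renyiOf α ρ ρ 1 = 0 := by
  rw [renyiOf_eq (suppLE_refl _) one_ne_zero]
  simp

lemma renyi_self {α : ℝ} (hα : 0 < α) {ρ : Matrix n n ℂ} (hρ : IsDensity ρ) :
    renyi α n ρ ρ = 0 := by
  have e : rpowOp ρ α * rpowOp ρ (1 - α) = ρ := by
    rw [rpowOp, rpowOp, ← cfc_mul _ _ ρ (continuousOn_spectrum _ _) (continuousOn_spectrum _ _)]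
    conv_rhs => rw [← cfc_id' ℝ ρ hρ.1.isHermitian.isSelfAdjoint]
    exact cfc_congr fun x hx =>
      rpow_mul_rpow_one_sub hα (spectrum_nonneg_of_posSemidef hρ.1 hx)
  rw [renyi, e, hρ.2, Complex.one_re, renyiOf_self]

lemma hasBinaryForm_renyi {α : ℝ} (hα0 : 0 < α) (hα : α ≠ 1) :
    HasBinaryForm (renyi α) fun p q => 1 / (α - 1) * Real.logb 2 (binQ α p q) where
  lower := fun h hσ hc => renyi_lower hα0 hα h hσ hc
  eq := fun h hp hq => renyi_blockState h hp hq
  self := fun hρ => renyi_self hα0 hρ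
  self' := fun hp => by simp [binQ_self hα0 hp]

/-! ### The sandwiched Rényi relative entropies -/

lemma rpowOp_mul_self {σ : Matrix n n ℂ} (hσ : σ.PosSemidef) {s : ℝ} (hs : s ≠ 0) :
    rpowOp σ s * rpowOp σ s = rpowOp σ (2 * s) := by
  rw [rpowOp, rpowOp, ← cfc_mul _ _ σ (continuousOn_spectrum _ _) (continuousOn_spectrum _ _)]
  refine cfc_congr fun x hx => ?_
  have hx := spectrum_nonneg_of_posSemidef hσ hx
  rcases hx.eq_or_lt with rfl | hx
  · simp [Real.zero_rpow hs, Real.zero_rpow (mul_ne_zero two_ne_zero hs)]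
  · rw [← Real.rpow_add hx, two_mul]

/-- The trace in the sandwiched Rényi relative entropy, with the roles of the factors exchanged. -/
lemma sandwiched_trace_eq (h : IsBlockProj P r r') {σ : Matrix n n ℂ} (hσ : σ.PosSemidef)
    {α p : ℝ} (hα0 : 0 < α) (hα : α ≠ 1) (hp : p ∈ Set.Icc (0 : ℝ) 1) :
    ∃ Y : Matrix n n ℂ, Y.PosSemidef ∧
      (rpowOp (rpowOp σ ((1 - α) / (2 * α)) * blockState P r r' p *
        rpowOp σ ((1 - α) / (2 * α))) α).trace.re =
        (P * rpowOp Y α).trace.re + ((1 - P) * rpowOp Y α).trace.re ∧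
      (P * Y).trace.re = p / r * (P * rpowOp σ ((1 - α) / α)).trace.re ∧
      ((1 - P) * Y).trace.re = (1 - p) / r' * ((1 - P) * rpowOp σ ((1 - α) / α)).trace.re := by
  have hs : (1 - α) / (2 * α) ≠ 0 := div_ne_zero (sub_ne_zero.2 (Ne.symm hα)) (by positivity)
  have hs2 : 2 * ((1 - α) / (2 * α)) = (1 - α) / α := by field_simp
  have hX2 := rpowOp_mul_self hσ hs
  rw [hs2] at hX2
  have hXh : (rpowOp σ ((1 - α) / (2 * α)))ᴴ = rpowOp σ ((1 - α) / (2 * α)) :=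
    cfc_isHermitian _ _
  set X := rpowOp σ ((1 - α) / (2 * α))
  have ha : 0 ≤ p / r := div_nonneg hp.1 h.pos.le
  have hb : 0 ≤ (1 - p) / r' := div_nonneg (by linarith [hp.2]) h.pos'.le
  -- `R` is the square root of the block state. With `X = σ^((1-α)/(2α))`, the sandwiched operator
  -- is `(XR)(RX)`, and `Y = (RX)(XR)` has the same trace of the power. The gain is that `R` is
  -- scalar on the blocks, so `Tr PY` is a multiple of `Tr P σ^((1-α)/α)`.
  set R : Matrix n n ℂ := √(p / r) • P + √((1 - p) / r') • (1 - P) with hR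
  have hRR : R * R = blockState P r r' p := by
    rw [hR, h.block_mul, Real.mul_self_sqrt ha, Real.mul_self_sqrt hb, blockState]
  have hRh : Rᴴ = R := by
    simp [hR, Matrix.conjTranspose_add, Matrix.conjTranspose_smul, h.herm.eq]
  have hY : R * rpowOp σ ((1 - α) / α) * R = (R * X) * (X * R) := by
    rw [← hX2]
    simp only [mul_assoc]
  have hcomm : ∀ c d : ℝ, R * (c • P + d • (1 - P)) * R =
      (p / r * c) • P + ((1 - p) / r' * d) • (1 - P) := by
    intro c d
    rw [hR, h.block_mul, h.block_mul, mul_right_comm, Real.mul_self_sqrt ha, mul_right_comm,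
      Real.mul_self_sqrt hb]
  have hP := hcomm 1 0
  have hP' := hcomm 0 1
  simp only [one_smul, zero_smul, add_zero, mul_one, mul_zero, zero_add] at hP hP'
  refine ⟨R * rpowOp σ ((1 - α) / α) * R, ?_, ?_, ?_, ?_⟩
  · have := (rpowOp_posSemidef hσ ((1 - α) / α)).conjTranspose_mul_mul_same R
    rwa [hRh] at this
  · have e1 : X * blockState P r r' p * X = (X * R) * (R * X) := by
      rw [← hRR]
      simp only [mul_assoc]
    have h1 : ((X * R) * (R * X)).IsHermitian := by
      simp [Matrix.IsHermitian, Matrix.conjTranspose_mul, hXh, hRh]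
    have h2 : ((R * X) * (X * R)).IsHermitian := by
      simp [Matrix.IsHermitian, Matrix.conjTranspose_mul, hXh, hRh]
    rw [hY, e1, rpowOp, trace_cfc_mul_comm h1 h2, rpowOp, ← Complex.add_re, ← Matrix.trace_add,
      ← add_mul]
    simp
  · rw [← mul_assoc, Matrix.trace_mul_comm, ← mul_assoc, ← mul_assoc, hP, smul_mul_assoc,
      Matrix.trace_smul]
    simp
  · rw [← mul_assoc, Matrix.trace_mul_comm, ← mul_assoc, ← mul_assoc, hP', smul_mul_assoc,
      Matrix.trace_smul]
    simp

lemma sandwichedRenyi_lower {α : ℝ} (hα0 : 1 / 2 ≤ α) (hα : α ≠ 1) (h : IsBlockProj P r r')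
    {σ : Matrix n n ℂ} (hσ : IsDensity σ) {p w : ℝ} (hc : Comparable p w (P * σ).trace.re) :
    ((1 / (α - 1) * Real.logb 2 (binQ α p w) : ℝ) : EReal) ≤
      sandwichedRenyi α n (blockState P r r' p) σ := by
  have hp1 : 0 ≤ 1 - p := by linarith [hc.le_one]
  have hα1 : 0 < α := by linarith
  obtain ⟨Y, hY, e, hPY, hPY'⟩ := sandwiched_trace_eq h hσ.1 hα1 hα ⟨hc.p_nonneg, hc.le_one⟩
  rw [sandwichedRenyi, e]
  refine le_renyiOf hα (hc.binQ_pos α) ?_ ?_ ?_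
  · exact add_nonneg (trace_mul_re_nonneg (rpowOp_posSemidef hY _) h.posSemidef)
      (trace_mul_re_nonneg (rpowOp_posSemidef hY _) h.compl.posSemidef)
  · intro h1 hs
    have b1 := block_sandwiched_bound_of_one_lt h hσ hY h1 hc.pos hc.p_nonneg hs hPY
    rw [← IsBlockProj.blockState_compl] at hs
    have b2 := block_sandwiched_bound_of_one_lt h.compl hσ hY h1 hc.pos' hp1 hs hPY'
    rw [trace_mul_compl hσ] at b2
    exact binQ_le_of_blocks h1 hc b1 b2
  · intro h1
    have b1 := block_sandwiched_bound_of_lt_one h hσ hY hα0 h1 hc.pos hc.p_nonneg hPY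
    have b2 := block_sandwiched_bound_of_lt_one h.compl hσ hY hα0 h1 hc.pos' hp1 hPY'
    rw [trace_mul_compl hσ] at b2
    exact le_binQ_of_blocks hα1 h1 hc b1 b2

lemma sandwich_rpow {α x y : ℝ} (hα : 0 < α) (hx : 0 ≤ x) (hy : 0 < y) :
    (y ^ ((1 - α) / (2 * α)) * x * y ^ ((1 - α) / (2 * α))) ^ α = x ^ α * y ^ (1 - α) := by
  have h1 : y ^ ((1 - α) / (2 * α)) * x * y ^ ((1 - α) / (2 * α)) = x * y ^ ((1 - α) / α) := by
    rw [mul_right_comm, ← Real.rpow_add hy, mul_comm]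
    congr 2
    field_simp
    ring
  rw [h1, Real.mul_rpow hx (Real.rpow_nonneg hy.le _), ← Real.rpow_mul hy.le,
    div_mul_cancel₀ _ hα.ne']

lemma sandwichedRenyi_blockState {α : ℝ} (hα : 0 < α) (h : IsBlockProj P r r') {p q : ℝ}
    (hp : p ∈ Set.Icc (0 : ℝ) 1) (hq : q ∈ Set.Ioo (0 : ℝ) 1) :
    sandwichedRenyi α n (blockState P r r' p) (blockState P r r' q) =
      ((1 / (α - 1) * Real.logb 2 (binQ α p q) : ℝ) : EReal) := by
  have hp1 : 0 ≤ 1 - p := by linarith [hp.2]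
  have hq1 : 0 < 1 - q := by linarith [hq.2]
  have e : (rpowOp (rpowOp (blockState P r r' q) ((1 - α) / (2 * α)) * blockState P r r' p *
      rpowOp (blockState P r r' q) ((1 - α) / (2 * α))) α).trace.re = binQ α p q := by
    rw [rpowOp_blockState h q]
    simp only [blockState]
    rw [h.block_mul, h.block_mul, rpowOp,
      h.cfc_block, h.trace_block, sandwich_rpow hα (div_nonneg hp.1 h.pos.le)
      (div_pos hq.1 h.pos), sandwich_rpow hα (div_nonneg hp1 h.pos'.le) (div_pos hq1 h.pos'),
      div_rpow_mul_div_rpow hp.1 hq.1 h.pos, div_rpow_mul_div_rpow hp1 hq1 h.pos', binQ]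
  rw [sandwichedRenyi, e]
  exact renyiOf_eq (h.suppLE_blockState _ hq.1 hq.2) (binQ_pos hp hq).ne'

lemma sandwichedRenyi_self {α : ℝ} (hα : 0 < α) {ρ : Matrix n n ℂ} (hρ : IsDensity ρ) :
    sandwichedRenyi α n ρ ρ = 0 := by
  have hid := cfc_id' ℝ ρ hρ.1.isHermitian.isSelfAdjoint
  have e : rpowOp (rpowOp ρ ((1 - α) / (2 * α)) * ρ * rpowOp ρ ((1 - α) / (2 * α))) α = ρ := by
    have e1 : rpowOp ρ ((1 - α) / (2 * α)) * ρ * rpowOp ρ ((1 - α) / (2 * α)) =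
        cfc (fun x : ℝ => x ^ ((1 - α) / (2 * α)) * x * x ^ ((1 - α) / (2 * α))) ρ := by
      rw [cfc_mul _ _ ρ (continuousOn_spectrum _ _) (continuousOn_spectrum _ _),
        cfc_mul _ _ ρ (continuousOn_spectrum _ _) (continuousOn_spectrum _ _), hid, rpowOp]
    rw [e1, rpowOp, ← cfc_comp (fun x : ℝ => x ^ α)
      (fun x : ℝ => x ^ ((1 - α) / (2 * α)) * x * x ^ ((1 - α) / (2 * α))) ρ
      hρ.1.isHermitian.isSelfAdjoint (continuousOn_image_spectrum _ _ _)
      (continuousOn_spectrum _ _)]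
    conv_rhs => rw [← hid]
    refine cfc_congr fun x hx => ?_
    have hx := spectrum_nonneg_of_posSemidef hρ.1 hx
    simp only [Function.comp_apply]
    rcases hx.eq_or_lt with rfl | hx
    · simp [Real.zero_rpow hα.ne']
    · rw [sandwich_rpow hα hx.le hx, rpow_mul_rpow_one_sub hα hx.le]
  rw [sandwichedRenyi, e, hρ.2, Complex.one_re, renyiOf_self]

lemma hasBinaryForm_sandwichedRenyi {α : ℝ} (hα0 : 1 / 2 ≤ α) (hα : α ≠ 1) :
    HasBinaryForm (sandwichedRenyi α) fun p q => 1 / (α - 1) * Real.logb 2 (binQ α p q) where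
  lower := fun h hσ hc => sandwichedRenyi_lower hα0 hα h hσ hc
  eq := fun h hp hq => sandwichedRenyi_blockState (by linarith) h hp hq
  self := fun hρ => sandwichedRenyi_self (by linarith) hρ
  self' := fun hp => by simp [binQ_self (by linarith : 0 < α) hp]

end Instances

open scoped Kronecker

/-! ### Operators acting on `A` and one of the systems `B_i` -/

section Embedding

variable {A B : Type} [Fintype A] [Fintype B] [DecidableEq A] [DecidableEq B] {k : ℕ}

/-- The operator `M` on `A B_i`, extended by the identity to `A B_1 ⋯ B_k`. -/
def emb (i : Fin k) (M : Matrix (A × B) (A × B) ℂ) :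
    Matrix (A × (Fin k → B)) (A × (Fin k → B)) ℂ :=
  fun x y => if ∀ j, j ≠ i → x.2 j = y.2 j then M (x.1, x.2 i) (y.1, y.2 i) else 0

omit [Fintype A] [DecidableEq A] in
lemma sum_agree_off (i : Fin k) (f : Fin k → B) (F : (Fin k → B) → ℂ) :
    ∑ g, (if ∀ j, j ≠ i → f j = g j then F g else 0) = ∑ b, F (Function.update f i b) := by
  rw [← Finset.sum_filter]
  symm
  refine Finset.sum_bij' (fun b _ => Function.update f i b) (fun g _ => g i) ?_ ?_ ?_ ?_ ?_
  · intro b _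
    simp +contextual
  · simp
  · simp
  · intro g hg
    ext j
    by_cases hj : j = i
    · subst hj; simp
    · simp [hj, (Finset.mem_filter.1 hg).2 j hj]
  · simp

omit [DecidableEq A] in
lemma emb_mulVec (i : Fin k) (M : Matrix (A × B) (A × B) ℂ) (ψ : A × (Fin k → B) → ℂ)
    (a : A) (f : Fin k → B) :
    (emb i M *ᵥ ψ) (a, f) = ∑ a', ∑ b, M (a, f i) (a', b) * ψ (a', Function.update f i b) := by
  simp only [Matrix.mulVec, dotProduct, Fintype.sum_prod_type, emb, ite_mul, zero_mul]
  refine Finset.sum_congr rfl fun a' _ => ?_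
  rw [sum_agree_off i f fun g => M (a, f i) (a', g i) * ψ (a', g)]
  simp

omit [DecidableEq A] in
lemma emb_mul_apply (i : Fin k) (M : Matrix (A × B) (A × B) ℂ)
    (N : Matrix (A × (Fin k → B)) (A × (Fin k → B)) ℂ) (x y : A × (Fin k → B)) :
    (emb i M * N) x y =
      ∑ a, ∑ b, M (x.1, x.2 i) (a, b) * N (a, Function.update x.2 i b) y :=
  emb_mulVec i M (fun z => N z y) x.1 x.2

omit [DecidableEq A] in
lemma mul_emb_apply (i : Fin k) (M : Matrix (A × B) (A × B) ℂ)
    (N : Matrix (A × (Fin k → B)) (A × (Fin k → B)) ℂ) (x y : A × (Fin k → B)) :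
    (N * emb i M) x y =
      ∑ a, ∑ b, N x (a, Function.update y.2 i b) * M (a, b) (y.1, y.2 i) := by
  simp only [Matrix.mul_apply, Fintype.sum_prod_type, emb, mul_ite, mul_zero]
  refine Finset.sum_congr rfl fun a _ => ?_
  simp only [eq_comm (b := y.2 _)]
  rw [sum_agree_off i y.2 fun g => N x (a, g) * M (a, g i) (y.1, y.2 i)]
  simp

omit [DecidableEq A] in
lemma emb_mul (i : Fin k) (M N : Matrix (A × B) (A × B) ℂ) :
    emb i (M * N) = emb i M * emb i N := by
  ext x y
  have h : ∀ b, (∀ j, j ≠ i → Function.update x.2 i b j = y.2 j) ↔ ∀ j, j ≠ i → x.2 j = y.2 j :=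
    fun b => forall₂_congr fun j hj => by rw [Function.update_of_ne hj]
  rw [emb_mul_apply]
  simp only [emb, Function.update_self, h, Matrix.mul_apply, Fintype.sum_prod_type]
  split_ifs <;> simp

omit [Fintype A] [Fintype B] [DecidableEq A] in
lemma emb_add (i : Fin k) (M N : Matrix (A × B) (A × B) ℂ) :
    emb i (M + N) = emb i M + emb i N := by
  ext x y
  simp only [emb, Matrix.add_apply]
  split_ifs <;> simp

omit [Fintype A] [Fintype B] [DecidableEq A] in
lemma emb_sub (i : Fin k) (M N : Matrix (A × B) (A × B) ℂ) :
    emb i (M - N) = emb i M - emb i N := by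
  ext x y
  simp only [emb, Matrix.sub_apply]
  split_ifs <;> simp

omit [Fintype A] [Fintype B] [DecidableEq A] in
lemma emb_zero (i : Fin k) : emb i (0 : Matrix (A × B) (A × B) ℂ) = 0 := by
  ext x y
  simp [emb]

omit [Fintype A] [Fintype B] [DecidableEq A] in
lemma emb_conjTranspose (i : Fin k) (M : Matrix (A × B) (A × B) ℂ) :
    (emb i M)ᴴ = emb i Mᴴ := by
  ext x y
  simp only [emb, Matrix.conjTranspose_apply, apply_ite star, star_zero, eq_comm]

omit [Fintype A] [Fintype B] in
omit [DecidableEq A] in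
lemma emb_kronecker_one (i : Fin k) (X : Matrix A A ℂ) :
    emb i (X ⊗ₖ (1 : Matrix B B ℂ)) = X ⊗ₖ (1 : Matrix (Fin k → B) (Fin k → B) ℂ) := by
  ext ⟨a, f⟩ ⟨a', g⟩
  have h : f = g ↔ (∀ j, j ≠ i → f j = g j) ∧ f i = g i := by
    constructor
    · rintro rfl
      simp
    · rintro ⟨h1, h2⟩
      ext j
      by_cases hj : j = i
      · subst hj; exact h2
      · exact h1 j hj
  simp only [emb, Matrix.kroneckerMap_apply, Matrix.one_apply, h, ite_and, mul_ite, mul_one, mul_zero]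

omit [Fintype A] [Fintype B] in
lemma emb_one (i : Fin k) : emb i (1 : Matrix (A × B) (A × B) ℂ) = 1 := by
  rw [← Matrix.one_kronecker_one, emb_kronecker_one, Matrix.one_kronecker_one]

lemma emb_commute_of_ne {i j : Fin k} (hij : j ≠ i) (M : Matrix (A × B) (A × B) ℂ)
    (Y : Matrix B B ℂ) : Commute (emb i M) (emb j ((1 : Matrix A A ℂ) ⊗ₖ Y)) := by
  change _ = _
  ext x y
  rw [emb_mul_apply, mul_emb_apply]
  have key : ∀ (f g : Fin k → B) (b : B),
      (∀ l, l ≠ j → Function.update f i b l = g l) ↔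
        (∀ l, l ≠ j → l ≠ i → f l = g l) ∧ b = g i := by
    intro f g b
    constructor
    · intro h
      refine ⟨fun l hl hl' => by simpa [hl'] using h l hl, by simpa using h i (Ne.symm hij)⟩
    · rintro ⟨h1, rfl⟩ l hl
      by_cases hl' : l = i
      · subst hl'; simp
      · simpa [hl'] using h1 l hl hl'
  have key' : ∀ (f g : Fin k → B) (b : B),
      (∀ l, l ≠ j → f l = Function.update g i b l) ↔
        (∀ l, l ≠ j → l ≠ i → f l = g l) ∧ b = f i := by
    intro f g b
    have := key g f b
    simp only [eq_comm (a := g _)] at this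
    rw [← this]
    exact forall₂_congr fun l _ => eq_comm
  simp only [emb, key, key', Matrix.kroneckerMap_apply, Matrix.one_apply,
    Function.update_of_ne hij, ite_and, ite_mul, mul_ite, one_mul, zero_mul, mul_zero]
  by_cases h : ∀ l, l ≠ j → l ≠ i → x.2 l = y.2 l
  · simp [Finset.sum_ite_irrel, mul_comm]
  · simp [h]

/-- The generator `X ⊗ 1 + ∑ⱼ Y_j` of a one-parameter group of local transformations. -/
def gen (k : ℕ) (X : Matrix A A ℂ) (Y : Matrix B B ℂ) :
    Matrix (A × (Fin k → B)) (A × (Fin k → B)) ℂ :=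
  X ⊗ₖ 1 + ∑ j, emb j ((1 : Matrix A A ℂ) ⊗ₖ Y)

/-- The summands of the generator at `j ≠ i` commute with an operator on `A Bᵢ`, so only the part on
`A Bᵢ` survives. -/
lemma emb_commutator (i : Fin k) (M : Matrix (A × B) (A × B) ℂ) (X : Matrix A A ℂ)
    (Y : Matrix B B ℂ) :
    emb i M * gen k X Y - gen k X Y * emb i M =
      emb i (M * (X ⊗ₖ 1 + 1 ⊗ₖ Y) - (X ⊗ₖ 1 + 1 ⊗ₖ Y) * M) := by
  have h : gen k X Y = emb i (X ⊗ₖ 1 + 1 ⊗ₖ Y) +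
      ∑ j ∈ Finset.univ.erase i, emb j ((1 : Matrix A A ℂ) ⊗ₖ Y) := by
    rw [gen, emb_add, emb_kronecker_one, add_assoc, 
      Finset.add_sum_erase _ (fun j => emb j ((1 : Matrix A A ℂ) ⊗ₖ Y)) (Finset.mem_univ i)]
  have hc : emb i M * ∑ j ∈ Finset.univ.erase i, emb j ((1 : Matrix A A ℂ) ⊗ₖ Y) =
      (∑ j ∈ Finset.univ.erase i, emb j ((1 : Matrix A A ℂ) ⊗ₖ Y)) * emb i M :=
    Commute.sum_right _ _ _ fun j hj => emb_commute_of_ne (Finset.ne_of_mem_erase hj) M Y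
  rw [h, mul_add, add_mul, hc, emb_sub, emb_mul, emb_mul]
  abel

/-- The sum of the operators `M` on `A B_i`. -/
def embSum (k : ℕ) (M : Matrix (A × B) (A × B) ℂ) :
    Matrix (A × (Fin k → B)) (A × (Fin k → B)) ℂ :=
  ∑ i, emb i M

lemma embSum_commute_gen {M : Matrix (A × B) (A × B) ℂ} {X : Matrix A A ℂ} {Y : Matrix B B ℂ}
    (h : Commute M (X ⊗ₖ 1 + 1 ⊗ₖ Y)) : Commute (embSum k M) (gen k X Y) := by
  refine Commute.sum_left _ _ _ fun i _ => ?_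
  have := emb_commutator i M X Y
  rw [h.eq, sub_self, emb_zero, sub_eq_zero] at this
  exact this

omit [Fintype A] [Fintype B] [DecidableEq A] in
lemma embSum_isHermitian {M : Matrix (A × B) (A × B) ℂ} (hM : M.IsHermitian) :
    (embSum k M).IsHermitian := by
  rw [Matrix.IsHermitian, embSum, Matrix.conjTranspose_sum]
  simp only [emb_conjTranspose, hM.eq]

omit [Fintype A] [Fintype B] [DecidableEq A] in
lemma emb_perm (π : Equiv.Perm (Fin k)) (i : Fin k) (M : Matrix (A × B) (A × B) ℂ) (a a' : A)
    (f g : Fin k → B) :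
    emb i M (a, f ∘ π) (a', g ∘ π) = emb (π i) M (a, f) (a', g) := by
  have : (∀ j, j ≠ i → (f ∘ π) j = (g ∘ π) j) ↔ ∀ j, j ≠ π i → f j = g j := by
    constructor
    · intro h j hj
      have := h (π.symm j) fun h' => hj (by rw [← h', Equiv.apply_symm_apply])
      simpa using this
    · intro h j hj
      exact h (π j) fun h' => hj (π.injective h')
  simp only [emb]
  exact if_congr this rfl rfl

omit [Fintype A] [Fintype B] [DecidableEq A] in
lemma embSum_permInvariant (M : Matrix (A × B) (A × B) ℂ) : PermInvariant (embSum k M) := by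
  intro π a a' f g
  simp only [embSum, Matrix.sum_apply, emb_perm]
  exact Equiv.sum_comp π fun i => emb i M (a, f) (a', g)

/-! ### Marginals -/

omit [DecidableEq A] in
-- The partial trace is dual to extension by the identity; statements about marginals are moved to
-- `ω` this way.
lemma trace_marginal_mul (i : Fin k) (ω : Matrix (A × (Fin k → B)) (A × (Fin k → B)) ℂ)
    (M : Matrix (A × B) (A × B) ℂ) : (marginal i ω * M).trace = (ω * emb i M).trace := by
  simp only [Matrix.trace, Matrix.diag, mul_emb_apply, Fintype.sum_prod_type]
  refine Finset.sum_congr rfl fun a _ => ?_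
  conv_rhs => rw [← Finset.sum_fiberwise Finset.univ fun f : Fin k → B => f i]
  refine Finset.sum_congr rfl fun b _ => ?_
  simp only [Matrix.mul_apply, Fintype.sum_prod_type, marginal, Finset.sum_mul]
  conv_rhs => rw [Finset.sum_comm]
  refine Finset.sum_congr rfl fun a' _ => ?_
  conv_rhs => rw [Finset.sum_comm]
  refine Finset.sum_congr rfl fun b' _ => Finset.sum_congr rfl fun f hf => ?_
  rw [(Finset.mem_filter.1 hf).2]

omit [DecidableEq A] in
lemma trace_mul_emb_eq {ω : Matrix (A × (Fin k → B)) (A × (Fin k → B)) ℂ} (hω : PermInvariant ω)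
    (M : Matrix (A × B) (A × B) ℂ) (i j : Fin k) :
    (ω * emb i M).trace = (ω * emb j M).trace := by
  let π : Equiv.Perm (Fin k) := Equiv.swap i j
  let e : A × (Fin k → B) ≃ A × (Fin k → B) :=
    (Equiv.refl A).prodCongr (Equiv.arrowCongr π (Equiv.refl B))
  have he : ∀ x, e x = (x.1, x.2 ∘ π) := fun x => rfl
  simp only [Matrix.trace, Matrix.diag, Matrix.mul_apply]
  rw [← Equiv.sum_comp e]
  refine Finset.sum_congr rfl fun x _ => ?_
  rw [← Equiv.sum_comp e]
  refine Finset.sum_congr rfl fun y _ => ?_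
  rw [he, he, hω, emb_perm, Equiv.swap_apply_left]

omit [DecidableEq A] in
lemma trace_mul_embSum {ω : Matrix (A × (Fin k → B)) (A × (Fin k → B)) ℂ} (hω : PermInvariant ω)
    (M : Matrix (A × B) (A × B) ℂ) (i : Fin k) :
    (ω * embSum k M).trace = k * (marginal i ω * M).trace := by
  rw [embSum, Finset.mul_sum, Matrix.trace_sum, trace_marginal_mul,
    Finset.sum_congr rfl fun j _ => trace_mul_emb_eq hω M j i]
  simp

omit [Fintype A] [DecidableEq A] in
-- A sum of principal compressions, which makes positivity evident. Pinning `g i` to `b₀` counts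
-- each configuration of the other systems once.
lemma marginal_eq_sum_submatrix (i : Fin k) (ω : Matrix (A × (Fin k → B)) (A × (Fin k → B)) ℂ)
    (b₀ : B) : marginal i ω = ∑ g : Fin k → B with g i = b₀,
      ω.submatrix (fun x : A × B => (x.1, Function.update g i x.2))
        (fun x : A × B => (x.1, Function.update g i x.2)) := by
  ext x y
  simp only [marginal, Matrix.sum_apply, Matrix.submatrix_apply]
  refine Finset.sum_bij' (fun f _ => Function.update f i b₀)
    (fun g _ => Function.update g i x.2) ?_ ?_ ?_ ?_ ?_
  · simp
  · simp
  · intro f hf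
    simp [← (Finset.mem_filter.1 hf).2]
  · intro g hg
    simp [← (Finset.mem_filter.1 hg).2]
  · intro f hf
    simp [← (Finset.mem_filter.1 hf).2]

lemma isDensity_marginal (i : Fin k) {ω : Matrix (A × (Fin k → B)) (A × (Fin k → B)) ℂ}
    (hω : IsDensity ω) : IsDensity (marginal i ω) := by
  constructor
  · rcases isEmpty_or_nonempty B with hB | ⟨⟨b₀⟩⟩
    · have : marginal i ω = 0 := by
        ext x
        exact hB.elim x.2
      rw [this]
      exact Matrix.PosSemidef.zero
    · rw [marginal_eq_sum_submatrix i ω b₀]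
      exact Matrix.posSemidef_sum _ fun g _ => hω.1.submatrix _
  · have := trace_marginal_mul i ω 1
    rwa [emb_one, mul_one, mul_one, hω.2] at this

lemma eq_of_trace_mul_eq {n : Type} [Fintype n] [DecidableEq n] {M N : Matrix n n ℂ}
    (h : ∀ X, (M * X).trace = (N * X).trace) : M = N :=
  Matrix.ext_iff_trace_mul_right.2 h

/-- Tested against any `M`, the commutator of the marginal becomes the trace of `ω` against a
commutator with the generator, which vanishes by cyclicity. -/
lemma marginal_commute {ω : Matrix (A × (Fin k → B)) (A × (Fin k → B)) ℂ} {X : Matrix A A ℂ}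
    {Y : Matrix B B ℂ} (h : Commute ω (gen k X Y)) (i : Fin k) :
    Commute (marginal i ω) (X ⊗ₖ 1 + 1 ⊗ₖ Y) := by
  refine eq_of_trace_mul_eq fun M => ?_
  have h1 := emb_commutator i M X Y
  have h2 : (ω * emb i (M * (X ⊗ₖ 1 + 1 ⊗ₖ Y) - (X ⊗ₖ 1 + 1 ⊗ₖ Y) * M)).trace = 0 := by
    rw [← h1, mul_sub, Matrix.trace_sub, ← mul_assoc, ← mul_assoc, h.eq,
      Matrix.trace_mul_comm, ← mul_assoc, sub_self]
  rw [← trace_marginal_mul, mul_sub, Matrix.trace_sub, sub_eq_zero] at h2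
  rw [mul_assoc, ← h2, ← mul_assoc, Matrix.trace_mul_comm, ← mul_assoc]

end Embedding

/-! ### Extendible states from eigenvectors -/

section Extendible

variable {A B : Type} [Fintype A] [Fintype B] [DecidableEq A] [DecidableEq B] {k : ℕ}

/-- The normalized eigenprojection of `embSum k M` is a symmetric extension. -/
lemma exists_mem_EXT_of_eigenvector (hk : 2 ≤ k) {M : Matrix (A × B) (A × B) ℂ}
    (hM : M.IsHermitian) {c : ℝ} {ψ : A × (Fin k → B) → ℂ} (hψ : ψ ≠ 0)
    (he : embSum k M *ᵥ ψ = (c : ℂ) • ψ) :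
    ∃ σ ∈ EXT A B k hk, (M * σ).trace = ((c / k : ℝ) : ℂ) ∧
      ∀ (X : Matrix A A ℂ) (Y : Matrix B B ℂ), Commute M (X ⊗ₖ 1 + 1 ⊗ₖ Y) →
        Commute σ (X ⊗ₖ 1 + 1 ⊗ₖ Y) := by
  set K := embSum k M with hK
  have hKh : K.IsHermitian := embSum_isHermitian hM
  -- The spectral projection of `K` at `c`. Being a function of `K`, it commutes with everything
  -- that commutes with `K`, which supplies both the permutation invariance and the local symmetry.
  set E : Matrix _ _ ℂ := cfc (fun x : ℝ => if x = c then (1 : ℝ) else 0) K with hE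
  have hEh : E.IsHermitian := cfc_isHermitian _ _
  have hEE : E * E = E := by
    rw [hE, ← cfc_mul _ _ K (continuousOn_spectrum _ _) (continuousOn_spectrum _ _)]
    exact cfc_congr fun x _ => by simp
  have hEK : E * K = c • E := by
    have hid := cfc_id' ℝ K hKh.isSelfAdjoint
    calc E * K = cfc (fun x : ℝ => (if x = c then (1 : ℝ) else 0) * x) K := by
          rw [cfc_mul _ _ K (continuousOn_spectrum _ _) (continuousOn_spectrum _ _), hid]
      _ = cfc (fun x : ℝ => c * if x = c then (1 : ℝ) else 0) K := by
          refine cfc_congr fun x _ => ?_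
          by_cases hx : x = c <;> simp [hx]
      _ = c • E := cfc_const_mul c _ K (continuousOn_spectrum _ _)
  have hc : c ∈ spectrum ℝ K := by
    rw [spectrum.mem_iff]
    intro hu
    obtain ⟨V, hV⟩ := hu.exists_left_inv
    apply hψ
    have h0 : (algebraMap ℝ (Matrix (A × (Fin k → B)) (A × (Fin k → B)) ℂ) c - K) *ᵥ ψ = 0 := by
      rw [Matrix.sub_mulVec, he, Algebra.algebraMap_eq_smul_one, Matrix.smul_mulVec,
        Matrix.one_mulVec, sub_eq_zero]
      ext x
      simp
    rw [← Matrix.one_mulVec ψ, ← hV, ← Matrix.mulVec_mulVec, h0, Matrix.mulVec_zero]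
  have hE0 : E ≠ 0 := by
    intro h0
    have h1 := cfc_map_spectrum (fun x : ℝ => if x = c then (1 : ℝ) else 0) K
      hKh.isSelfAdjoint (continuousOn_spectrum _ _)
    have hne : Nonempty (A × (Fin k → B)) := by
      by_contra hne
      rw [not_nonempty_iff] at hne
      exact hψ (Subsingleton.elim _ _)
    rw [← hE, h0, spectrum.zero_eq] at h1
    have h2 : (1 : ℝ) ∈ ({0} : Set ℝ) := by
      rw [h1]
      exact ⟨c, hc, by simp⟩
    exact one_ne_zero h2
  have hEp := posSemidef_of_idem hEh hEE
  have htr : E.trace = (E.trace.re : ℂ) := 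
    Complex.ext (by simp) (by simpa using (Complex.nonneg_iff.1 hEp.trace_nonneg).2.symm)
  have hpos : 0 < E.trace.re := by
    refine lt_of_le_of_ne (trace_re_nonneg hEp) fun h0 => hE0 ?_
    rw [← h0, Complex.ofReal_zero] at htr
    exact hEp.trace_eq_zero_iff.1 htr
  set ω := E.trace.re⁻¹ • E with hω
  have hωd : IsDensity ω := by
    refine ⟨hEp.smul (inv_nonneg.2 hpos.le), ?_⟩
    rw [hω, Matrix.trace_smul, htr, Complex.real_smul, ← Complex.ofReal_mul, Complex.ofReal_re,
      inv_mul_cancel₀ hpos.ne', Complex.ofReal_one]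
  have hcomm : ∀ N, Commute K N → Commute ω N := by
    intro N hN
    exact (hN.cfc_real _).smul_left _
  have hperm : PermInvariant ω := by
    intro π a a' f g
    let e : A × (Fin k → B) ≃ A × (Fin k → B) :=
      (Equiv.refl A).prodCongr (Equiv.arrowCongr π.symm (Equiv.refl B))
    -- The permutation matrix of `e`: commuting with it is the same as invariance of the entries.
    let Q : Matrix (A × (Fin k → B)) (A × (Fin k → B)) ℂ := fun x y => if x = e y then 1 else 0
    have hQ : ∀ N : Matrix (A × (Fin k → B)) (A × (Fin k → B)) ℂ,
        Commute N Q ↔ ∀ x y, N (e x) (e y) = N x y := by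
      intro N
      have h1 : ∀ x y, (N * Q) (e x) y = N (e x) (e y) := by
        intro x y
        rw [Matrix.mul_apply]
        simp [Q]
      have h2 : ∀ x y, (Q * N) (e x) y = N x y := by
        intro x y
        rw [Matrix.mul_apply]
        simp [Q]
      constructor
      · intro h x y
        rw [← h1, ← h2, h.eq]
      · intro h
        change _ = _
        ext x y
        obtain ⟨x, rfl⟩ := e.surjective x
        rw [h1, h2, h]
    have hKe : Commute K Q := (hQ K).2 fun x y => embSum_permInvariant M π x.1 y.1 x.2 y.2
    exact (hQ ω).1 (hcomm _ hKe) (a, f) (a', g)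
  have hk0 : (k : ℂ) ≠ 0 := by
    have : k ≠ 0 := by omega
    exact_mod_cast this
  refine ⟨marginal ⟨0, by omega⟩ ω, ⟨isDensity_marginal _ hωd, ω, hωd, hperm, rfl⟩, ?_, ?_⟩
  · have h1 := trace_mul_embSum hperm M ⟨0, by omega⟩
    rw [hω, smul_mul_assoc, ← hK, hEK, smul_comm, ← hω, Matrix.trace_smul, hωd.2] at h1
    rw [Matrix.trace_mul_comm, Complex.ofReal_div, eq_div_iff (by simpa using hk0), mul_comm]
    rw [Complex.ofReal_natCast, ← h1]
    simp
  · intro X Y hXY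
    exact marginal_commute (hcomm _ (embSum_commute_gen hXY)) _

/-- The hypothesis says that `μ - K` is positive semidefinite; its trace against `ω` is `μ - k
Tr(Mσ)`. -/
lemma trace_mul_le_of_mem_EXT (hk : 2 ≤ k) {M : Matrix (A × B) (A × B) ℂ}
    (hM : M.IsHermitian) {μ : ℝ}
    (h : ∀ (l : ℝ) (ψ : A × (Fin k → B) → ℂ), ψ ≠ 0 → embSum k M *ᵥ ψ = (l : ℂ) • ψ → l ≤ μ)
    {σ : Matrix (A × B) (A × B) ℂ} (hσ : σ ∈ EXT A B k hk) :
    (M * σ).trace.re ≤ μ / k := by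
  obtain ⟨-, ω, hω, hperm, rfl⟩ := hσ
  have hKh : (embSum k M).IsHermitian := embSum_isHermitian hM
  have hN : (μ • (1 : Matrix (A × (Fin k → B)) (A × (Fin k → B)) ℂ) - embSum k M).IsHermitian :=
    (Matrix.isHermitian_one.smul (IsSelfAdjoint.all μ)).sub hKh
  have hp : (μ • (1 : Matrix (A × (Fin k → B)) (A × (Fin k → B)) ℂ) - embSum k M).PosSemidef := by
    rw [hN.posSemidef_iff_eigenvalues_nonneg]
    intro j
    have h1 := hN.mulVec_eigenvectorBasis j
    have h2 := h (μ - hN.eigenvalues j) (hN.eigenvectorBasis j).ofLp ?_ ?_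
    · simp only [Pi.zero_apply]
      linarith
    · intro h0
      have := hN.eigenvectorBasis.orthonormal.ne_zero j
      exact this (by ext x; exact congrFun h0 x)
    · rw [Matrix.sub_mulVec, Matrix.smul_mulVec, Matrix.one_mulVec] at h1
      have h3 : embSum k M *ᵥ (hN.eigenvectorBasis j).ofLp =
          μ • (hN.eigenvectorBasis j).ofLp -
            hN.eigenvalues j • (hN.eigenvectorBasis j).ofLp := by
        rw [← h1]; abel
      rw [h3]
      ext x
      simp [sub_mul]
  have h4 := trace_mul_re_nonneg hp hω.1
  rw [mul_sub, Matrix.trace_sub, mul_smul_comm, mul_one, Matrix.trace_smul, hω.2,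
    trace_mul_embSum hperm M ⟨0, by omega⟩, Matrix.trace_mul_comm] at h4
  have hk0 : (0 : ℝ) < k := by exact_mod_cast (by omega : 0 < k)
  rw [le_div_iff₀ hk0, mul_comm]
  simpa using h4

omit [Fintype A] [DecidableEq A] in
lemma marginal_add_smul (i : Fin k) (s t : ℝ)
    (ω ω' : Matrix (A × (Fin k → B)) (A × (Fin k → B)) ℂ) :
    marginal i (s • ω + t • ω') = s • marginal i ω + t • marginal i ω' := by
  ext x y
  simp [marginal, Finset.sum_add_distrib, Finset.mul_sum]

lemma IsDensity.convex {n : Type} [Fintype n] {ρ σ : Matrix n n ℂ} (hρ : IsDensity ρ)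
    (hσ : IsDensity σ) {s t : ℝ} (hs : 0 ≤ s) (ht : 0 ≤ t) (hst : s + t = 1) :
    IsDensity (s • ρ + t • σ) := by
  refine ⟨(hρ.1.smul hs).add (hσ.1.smul ht), ?_⟩
  rw [Matrix.trace_add, Matrix.trace_smul, Matrix.trace_smul, hρ.2, hσ.2, ← add_smul, hst,
    one_smul]

omit [DecidableEq A] in
lemma EXT_convex (hk : 2 ≤ k) {σ σ' : Matrix (A × B) (A × B) ℂ} (hσ : σ ∈ EXT A B k hk)
    (hσ' : σ' ∈ EXT A B k hk) {s t : ℝ} (hs : 0 ≤ s) (ht : 0 ≤ t) (hst : s + t = 1) :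
    s • σ + t • σ' ∈ EXT A B k hk := by
  obtain ⟨h1, ω, h2, h3, rfl⟩ := hσ
  obtain ⟨h1', ω', h2', h3', rfl⟩ := hσ'
  refine ⟨h1.convex h1' hs ht hst, s • ω + t • ω', h2.convex h2' hs ht hst, ?_,
    marginal_add_smul _ _ _ _ _⟩
  intro π a a' f g
  simp [h3 π a a' f g, h3' π a a' f g]

/-- Block states are affine in their weight: `q` is the mixture of `0` and `q₁` with coefficient `q
/ q₁`. -/
lemma blockState_mem_EXT (hk : 2 ≤ k) {P : Matrix (A × B) (A × B) ℂ} {r r' q₁ : ℝ}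
    (h0 : blockState P r r' 0 ∈ EXT A B k hk) (h1 : blockState P r r' q₁ ∈ EXT A B k hk)
    (hq₁ : 0 < q₁) {q : ℝ} (hq : q ∈ Set.Icc 0 q₁) : blockState P r r' q ∈ EXT A B k hk := by
  have hle : q / q₁ ≤ 1 := (div_le_one hq₁).2 hq.2
  have := EXT_convex hk h0 h1 (sub_nonneg.2 hle) (div_nonneg hq.1 hq₁.le) (by ring)
  convert this using 1
  have e : q / q₁ * q₁ = q := div_mul_cancel₀ _ hq₁.ne'
  simp only [blockState, smul_add, smul_smul]
  have e1 : q / r = (1 - q / q₁) * (0 / r) + q / q₁ * (q₁ / r) := by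
    rw [zero_div, mul_zero, zero_add, ← mul_div_assoc, e]
  have e2 : (1 - q) / r' = (1 - q / q₁) * ((1 - 0) / r') + q / q₁ * ((1 - q₁) / r') := by
    rw [← mul_div_assoc, ← mul_div_assoc, ← add_div]
    congr 1
    linear_combination e
  rw [e1, e2, add_smul, add_smul]
  abel

end Extendible

/-! ### Operators commuting with all `X ⊗ 1 + 1 ⊗ X` -/

lemma eq_blockState_of_eq {n : Type} [Fintype n] [DecidableEq n] {P σ : Matrix n n ℂ} {r r' : ℝ}
    (h : IsBlockProj P r r') (hσ : IsDensity σ) {c c' : ℂ} (he : σ = c • P + c' • (1 - P))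
    {q : ℝ} (hq : (P * σ).trace = q) : σ = blockState P r r' q := by
  have hr : (r : ℂ) ≠ 0 := by exact_mod_cast h.pos.ne'
  have hr' : (r' : ℂ) ≠ 0 := by exact_mod_cast h.pos'.ne'
  have h2 : (1 - P) * P = 0 := by simpa using h.compl.mul_compl
  have h1 : c * r = q := by
    rw [← hq, he, mul_add, mul_smul_comm, mul_smul_comm, h.idem, h.mul_compl, smul_zero, add_zero,
      Matrix.trace_smul, h.trace, smul_eq_mul]
  have h3 : c' * r' = 1 - q := by
    have := hσ.2
    rw [he, Matrix.trace_add, Matrix.trace_smul, Matrix.trace_smul, h.trace, h.trace',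
      smul_eq_mul, smul_eq_mul, h1] at this
    rw [← this]; ring
  rw [he, blockState, ← eq_div_iff hr] at *
  rw [← eq_div_iff hr'] at h3
  rw [h1, h3]
  ext i j
  simp

/-- For a matrix unit `Z = E_{xj}`, the `(i, j)` entry of the commutation reads `(σQ)_{ix} Q_{jj} =
Q_{ix} (Qσ)_{jj}`. Summing over `j` gives the scalar as a quotient of traces. -/
lemma mul_proj_eq_smul {n : Type} [Fintype n] [DecidableEq n] {σ Q : Matrix n n ℂ}
    (htr : Q.trace ≠ 0) (h : ∀ Z, Commute σ (Q * Z * Q)) :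
    ∃ c : ℂ, σ * Q = c • Q := by
  refine ⟨(Q * σ).trace / Q.trace, ?_⟩
  ext i x
  have h1 : ∀ j, (σ * Q) i x * Q j j = Q i x * (Q * σ) j j := by
    intro j
    have h2 := congrFun (congrFun (h (Matrix.single x j 1)).eq i) j
    rw [← mul_assoc, ← mul_assoc, mul_assoc (Q * _), Matrix.mul_assoc, Matrix.mul_assoc Q] at h2
    have key : ∀ M N : Matrix n n ℂ, (M * (Matrix.single x j (1 : ℂ) * N)) i j = M i x * N j j := by
      intro M N
      rw [Matrix.mul_apply, Finset.sum_eq_single x]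
      · simp
      · intro b _ hb
        simp [Matrix.single_mul_apply_of_ne, hb]
      · simp
    rwa [key, key] at h2
  have h3 := Finset.sum_congr (rfl : (Finset.univ : Finset n) = Finset.univ) fun j _ => h1 j
  rw [← Finset.mul_sum, ← Finset.mul_sum] at h3
  rw [Matrix.smul_apply, smul_eq_mul, div_mul_eq_mul_div, eq_div_iff htr]
  change (σ * Q) i x * Q.trace = Q i x * (Q * σ).trace at h3
  rw [h3, mul_comm]

section Swap

variable {d : ℕ}

lemma swapOp_mul_apply (M : Matrix (Fin d × Fin d) (Fin d × Fin d) ℂ) (x y : Fin d × Fin d) :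
    (swapOp d * M) x y = M x.swap y := by
  rw [Matrix.mul_apply, Finset.sum_eq_single x.swap]
  · simp [swapOp]
  · intro z _ hz
    have : ¬ (x.1 = z.2 ∧ x.2 = z.1) := fun h => hz (by ext <;> simp [h.1, h.2])
    simp [swapOp, this]
  · simp

lemma mul_swapOp_apply (M : Matrix (Fin d × Fin d) (Fin d × Fin d) ℂ) (x y : Fin d × Fin d) :
    (M * swapOp d) x y = M x y.swap := by
  rw [Matrix.mul_apply, Finset.sum_eq_single y.swap]
  · simp [swapOp]
  · intro z _ hz
    have : ¬ (z.1 = y.2 ∧ z.2 = y.1) := fun h => hz (by ext <;> simp [h.1, h.2])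
    simp [swapOp, this]
  · simp

lemma swapOp_mul_self : swapOp d * swapOp d = 1 := by
  ext x y
  rw [swapOp_mul_apply]
  simp [swapOp, Matrix.one_apply, Prod.ext_iff, and_comm]

lemma swapOp_isHermitian : (swapOp d).IsHermitian := by
  ext x y
  simp only [swapOp, Matrix.conjTranspose_apply, apply_ite star, star_one, star_zero]
  exact if_congr ⟨fun h => ⟨h.2.symm, h.1.symm⟩, fun h => ⟨h.2.symm, h.1.symm⟩⟩ rfl rfl

lemma swapOp_conj_kronecker (X Y : Matrix (Fin d) (Fin d) ℂ) :
    swapOp d * (X ⊗ₖ Y) * swapOp d = Y ⊗ₖ X := by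
  ext x y
  rw [mul_swapOp_apply, swapOp_mul_apply]
  simp [mul_comm]

lemma swapOp_commute (X : Matrix (Fin d) (Fin d) ℂ) :
    Commute (swapOp d) (X ⊗ₖ 1 + 1 ⊗ₖ X) := by
  change _ = _
  ext ⟨a, b⟩ ⟨a', b'⟩
  rw [mul_swapOp_apply, swapOp_mul_apply]
  simp only [Prod.swap_prod_mk, Matrix.add_apply, Matrix.kroneckerMap_apply]
  ring

lemma commute_add_swap_conj {σ : Matrix (Fin d × Fin d) (Fin d × Fin d) ℂ}
    (h : ∀ X : Matrix (Fin d) (Fin d) ℂ, Commute σ (X ⊗ₖ 1 + 1 ⊗ₖ X))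
    (Z : Matrix (Fin d × Fin d) (Fin d × Fin d) ℂ) :
    Commute σ (Z + swapOp d * Z * swapOp d) := by
  have hXY : ∀ X Y : Matrix (Fin d) (Fin d) ℂ, Commute σ (X ⊗ₖ Y + Y ⊗ₖ X) := by
    intro X Y
    have h1 := ((h X).mul_right (h Y)).sub_right (h (X * Y))
    -- Polarization: products of generators minus a generator yield all symmetrized tensors, and
    -- these span the operators `Z + FZF`.
    have e : X ⊗ₖ Y + Y ⊗ₖ X = (X ⊗ₖ (1 : Matrix (Fin d) (Fin d) ℂ) + 1 ⊗ₖ X) *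
        (Y ⊗ₖ (1 : Matrix (Fin d) (Fin d) ℂ) + 1 ⊗ₖ Y) - ((X * Y) ⊗ₖ 1 + 1 ⊗ₖ (X * Y)) := by
      rw [add_mul, mul_add, mul_add]
      simp only [← Matrix.mul_kronecker_mul, one_mul, mul_one]
      abel
    rwa [e]
  induction Z using Matrix.induction_on' with
  | h_zero => simp
  | h_add M N hM hN =>
    have := hM.add_right hN
    have e : M + N + swapOp d * (M + N) * swapOp d =
        M + swapOp d * M * swapOp d + (N + swapOp d * N * swapOp d) := by
      rw [mul_add, add_mul]
      abel
    rwa [e]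
  | h_std_basis i j x =>
    have e : Matrix.single i j x = (Matrix.single i.1 j.1 x) ⊗ₖ (Matrix.single i.2 j.2 (1 : ℂ)) := by
      rw [Matrix.single_kronecker_single, mul_one]
    rw [e, swapOp_conj_kronecker]
    exact hXY _ _

lemma antiProj_add_symProj : antiProj d + symProj d = 1 := by
  rw [antiProj, symProj, ← smul_add]
  ext x y
  simp
  ring

lemma one_sub_antiProj : 1 - antiProj d = symProj d := by
  rw [← antiProj_add_symProj (d := d)]
  abel

lemma antiProj_idem : antiProj d * antiProj d = antiProj d := by
  have : (1 - swapOp d) * (1 - swapOp d) = (2 : ℝ) • (1 - swapOp d) := by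
    simp only [mul_sub, sub_mul, one_mul, mul_one, swapOp_mul_self, two_smul]
    abel
  rw [antiProj, smul_mul_smul_comm, this, smul_smul]
  norm_num

lemma trace_swapOp : (swapOp d).trace = d := by
  simp only [Matrix.trace, Matrix.diag, swapOp, Fintype.sum_prod_type]
  simp [eq_comm]

lemma isBlockProj_antiProj (hd : 2 ≤ d) :
    IsBlockProj (antiProj d) ((d : ℝ) * (d - 1) / 2) ((d : ℝ) * (d + 1) / 2) := by
  have hd' : (2 : ℝ) ≤ d := by exact_mod_cast hd
  refine ⟨?_, antiProj_idem, ?_, ?_, ?_, ?_⟩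
  · exact (Matrix.isHermitian_one.sub swapOp_isHermitian).smul (IsSelfAdjoint.all _)
  · have : (0 : ℝ) < d - 1 := by linarith
    positivity
  · positivity
  · rw [antiProj, Matrix.trace_smul, Matrix.trace_sub, trace_swapOp]
    simp
    ring
  · rw [one_sub_antiProj, symProj, Matrix.trace_smul, Matrix.trace_add, trace_swapOp]
    simp
    ring

lemma werner_eq_blockState (p : ℝ) (d : ℕ) : werner p d =
    blockState (antiProj d) ((d : ℝ) * (d - 1) / 2) ((d : ℝ) * (d + 1) / 2) p := by
  rw [werner, blockState, one_sub_antiProj, add_comm, div_div_eq_mul_div, div_div_eq_mul_div,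
    mul_div_assoc, mul_div_assoc]

/-- The commutant of the operators `X ⊗ 1 + 1 ⊗ X` is spanned by `1` and the swap. -/
lemma exists_eq_of_commute (hd : 2 ≤ d) {σ : Matrix (Fin d × Fin d) (Fin d × Fin d) ℂ}
    (h : ∀ X : Matrix (Fin d) (Fin d) ℂ, Commute σ (X ⊗ₖ 1 + 1 ⊗ₖ X)) :
    ∃ c c' : ℂ, σ = c • antiProj d + c' • (1 - antiProj d) := by
  have hP := isBlockProj_antiProj hd
  -- If `FQ = QF = εQ` with `ε² = 1`, then `QZQ` is fixed by conjugation with the swap, so `σ`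
  -- commutes with it. The cases `ε = -1` and `ε = 1` are the two blocks.
  have hF : ∀ (Q : Matrix (Fin d × Fin d) (Fin d × Fin d) ℂ) (ε : ℂ), ε * ε = 1 →
      swapOp d * Q = ε • Q → Q * swapOp d = ε • Q → ∀ Z, Commute σ (Q * Z * Q) := by
    intro Q ε hε h1 h2 Z
    have h3 := commute_add_swap_conj h (Q * Z * Q)
    have h4 : swapOp d * (Q * Z * Q) * swapOp d = Q * Z * Q := by
      have e : swapOp d * (Q * Z * Q) * swapOp d = (swapOp d * Q) * Z * (Q * swapOp d) := by
        simp only [mul_assoc]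
      rw [e, h1, h2]
      simp [smul_smul, hε]
    rw [h4, ← two_smul ℂ] at h3
    have := h3.smul_right ((2 : ℂ)⁻¹)
    rwa [smul_smul, inv_mul_cancel₀ two_ne_zero, one_smul] at this
  have hFa : swapOp d * antiProj d = (-1 : ℂ) • antiProj d := by
    rw [antiProj, mul_smul_comm, mul_sub, swapOp_mul_self, mul_one, smul_comm, neg_one_smul, neg_sub]
  have hFa' : antiProj d * swapOp d = (-1 : ℂ) • antiProj d := by
    rw [antiProj, smul_mul_assoc, sub_mul, swapOp_mul_self, one_mul, smul_comm, neg_one_smul,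
      neg_sub]
  have hFs : swapOp d * symProj d = (1 : ℂ) • symProj d := by
    rw [symProj, mul_smul_comm, mul_add, swapOp_mul_self, mul_one, one_smul, add_comm]
  have hFs' : symProj d * swapOp d = (1 : ℂ) • symProj d := by
    rw [symProj, smul_mul_assoc, add_mul, swapOp_mul_self, one_mul, one_smul, add_comm]
  obtain ⟨c, hc⟩ := mul_proj_eq_smul (σ := σ)
    (by rw [hP.trace]; exact_mod_cast hP.pos.ne') (hF _ (-1) (by norm_num) hFa hFa')
  have hPs := hP.compl
  rw [one_sub_antiProj] at hPs
  obtain ⟨c', hc'⟩ := mul_proj_eq_smul (σ := σ)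
    (by rw [hPs.trace]; exact_mod_cast hPs.pos.ne') (hF _ 1 (by norm_num) hFs hFs')
  refine ⟨c, c', ?_⟩
  rw [one_sub_antiProj, ← hc, ← hc', ← mul_add, antiProj_add_symProj, mul_one]

end Swap

section Spectra

variable {d k : ℕ}

/-! ### The sum of the swaps -/

lemma embSum_swapOp_mulVec (ψ : Fin d × (Fin k → Fin d) → ℂ) (x : Fin d) (f : Fin k → Fin d) :
    (embSum k (swapOp d) *ᵥ ψ) (x, f) = ∑ i, ψ (f i, Function.update f i x) := by
  rw [embSum, Matrix.sum_mulVec, Finset.sum_apply]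
  refine Finset.sum_congr rfl fun i _ => ?_
  rw [emb_mulVec]
  simp [swapOp, ite_and]

/-- The amplitude at a word is read off with one letter `a` replaced by `b`. For `a < b` this lowers
the letter sum on the support. -/
lemma gen_single_mulVec (a b : Fin d) (ψ : Fin d × (Fin k → Fin d) → ℂ) (x : Fin d)
    (f : Fin k → Fin d) :
    (gen k (Matrix.single a b (1 : ℂ)) (Matrix.single a b (1 : ℂ)) *ᵥ ψ) (x, f) =
      (if a = x then ψ (b, f) else 0) +
        ∑ i, if a = f i then ψ (x, Function.update f i b) else 0 := by
  rw [gen, Matrix.add_mulVec, Matrix.sum_mulVec, Pi.add_apply, Finset.sum_apply]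
  congr 1
  · simp [Matrix.mulVec, dotProduct, Fintype.sum_prod_type, Matrix.single_apply,
      Matrix.one_apply, ite_and]
  · refine Finset.sum_congr rfl fun i _ => ?_
    rw [emb_mulVec]
    simp [Matrix.single_apply, Matrix.one_apply, ite_and]

lemma sum_val_update (f : Fin k → Fin d) (i : Fin k) (b : Fin d) :
    ∑ j, (Function.update f i b j : ℕ) + (f i : ℕ) = ∑ j, (f j : ℕ) + (b : ℕ) := by
  rw [← Finset.add_sum_erase _ _ (Finset.mem_univ i),
    ← Finset.add_sum_erase _ (fun j => (f j : ℕ)) (Finset.mem_univ i),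
    Finset.sum_congr rfl fun j hj => by
      rw [Function.update_of_ne (Finset.ne_of_mem_erase hj)]]
  simp
  ring

/-- Every eigenspace of the sum of the swaps contains a vector that is annihilated by all
raising operators. -/
lemma exists_highestWeight {l : ℂ} {ψ : Fin d × (Fin k → Fin d) → ℂ} (hψ : ψ ≠ 0)
    (he : embSum k (swapOp d) *ᵥ ψ = l • ψ) :
    ∃ φ : Fin d × (Fin k → Fin d) → ℂ, φ ≠ 0 ∧ embSum k (swapOp d) *ᵥ φ = l • φ ∧
      ∀ a b : Fin d, a < b →
        gen k (Matrix.single a b (1 : ℂ)) (Matrix.single a b (1 : ℂ)) *ᵥ φ = 0 := by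
  classical
  let wt : Fin d × (Fin k → Fin d) → ℕ := fun z => z.1 + ∑ j, (z.2 j : ℕ)
  -- The least bound on the letter sum over all eigenvectors; a minimizer is annihilated by every
  -- raising operator.
  let good : ℕ → Prop := fun n => ∃ φ : Fin d × (Fin k → Fin d) → ℂ, φ ≠ 0 ∧
    embSum k (swapOp d) *ᵥ φ = l • φ ∧ ∀ z, φ z ≠ 0 → wt z < n
  have hex : ∃ n, good n :=
    ⟨Finset.univ.sup wt + 1, ψ, hψ, he, fun z _ =>
      Nat.lt_succ_of_le (Finset.le_sup (f := wt) (Finset.mem_univ z))⟩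
  obtain ⟨φ, hφ, hφe, hφw⟩ := Nat.find_spec hex
  refine ⟨φ, hφ, hφe, fun a b hab => ?_⟩
  by_contra hne
  have hlow : ∀ z, (gen k (Matrix.single a b (1 : ℂ)) (Matrix.single a b (1 : ℂ)) *ᵥ φ) z ≠ 0 →
      wt z + 1 < Nat.find hex := by
    rintro ⟨x, f⟩ hz
    rw [gen_single_mulVec] at hz
    have hab' : (a : ℕ) < b := hab
    by_cases h1 : a = x ∧ φ (b, f) ≠ 0
    · have h2 := hφw _ h1.2
      have : (a : ℕ) = x := by rw [h1.1]
      simp only [wt] at h2 ⊢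
      omega
    · have h2 : (if a = x then φ (b, f) else 0) = 0 := by
        split_ifs with h
        · by_contra h'
          exact h1 ⟨h, h'⟩
        · rfl
      rw [h2, zero_add] at hz
      obtain ⟨i, -, hi⟩ := Finset.exists_ne_zero_of_sum_ne_zero hz
      have h3 : a = f i := by
        by_contra h'
        exact hi (if_neg h')
      rw [if_pos h3] at hi
      have h4 := hφw _ hi
      have h5 := sum_val_update f i b
      have : (a : ℕ) = f i := by rw [h3]
      simp only [wt] at h4 ⊢
      omega
  obtain ⟨z, hz⟩ := Function.ne_iff.1 hne
  have hpos := hlow z hz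
  -- A nonzero image under a raising operator would be an eigenvector for the same `l` with letter
  -- sums bounded by one less.
  refine Nat.find_min hex (m := Nat.find hex - 1) (by omega) ⟨_, hne, ?_, fun z hz => ?_⟩
  · rw [Matrix.mulVec_mulVec, (embSum_commute_gen (swapOp_commute _)).eq, ← Matrix.mulVec_mulVec,
      hφe, Matrix.mulVec_smul]
  · have := hlow z hz
    omega

/-- For a highest weight vector, evaluated at a word whose letter `a` at `A` is the largest
possible, the eigenvalue is the number of `i` with `f i = a` minus `a`. This is the content of a box
in a Young diagram. -/
lemma eigenvalue_swapOp_ge {l : ℝ} {ψ : Fin d × (Fin k → Fin d) → ℂ} (hψ : ψ ≠ 0)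
    (he : embSum k (swapOp d) *ᵥ ψ = (l : ℂ) • ψ) : -((d : ℝ) - 1) ≤ l := by
  classical
  obtain ⟨φ, hφ, hφe, hw⟩ := exists_highestWeight hψ he
  let s : Finset (Fin d) := Finset.univ.filter fun a => ∃ f, φ (a, f) ≠ 0
  have hs : s.Nonempty := by
    obtain ⟨⟨a, f⟩, h⟩ := Function.ne_iff.1 hφ
    exact ⟨a, Finset.mem_filter.2 ⟨Finset.mem_univ _, f, h⟩⟩
  have ha := s.max'_mem hs
  have hmax : ∀ c, s.max' hs < c → ∀ f, φ (c, f) = 0 := by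
    intro c hc f
    by_contra h
    exact absurd (s.le_max' c (Finset.mem_filter.2 ⟨Finset.mem_univ _, f, h⟩)) (not_le.2 hc)
  set a := s.max' hs
  obtain ⟨-, f, hf⟩ := Finset.mem_filter.1 ha
  have h1 := congrFun hφe (a, f)
  rw [embSum_swapOp_mulVec] at h1
  have h2 : ∑ i, φ (f i, Function.update f i a) =
      ∑ c, ∑ i, if c = f i then φ (c, Function.update f i a) else 0 := by
    rw [Finset.sum_comm]
    simp
  -- Grouped by the letter `c` that moves to `A`: each `c < a` contributes `-1` by the raising
  -- operator from `c` to `a`, `c = a` contributes its multiplicity, and `c > a` vanishes by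
  -- maximality.
  have h3 : ∀ c, (∑ i, if c = f i then φ (c, Function.update f i a) else 0) =
      ((if c < a then -1 else 0) +
        if c = a then ((Finset.univ.filter fun i => a = f i).card : ℂ) else 0) * φ (a, f) := by
    intro c
    rcases lt_trichotomy c a with hc | hc | hc
    · have := congrFun (hw c a hc) (c, f)
      rw [gen_single_mulVec, if_pos rfl, Pi.zero_apply] at this
      rw [if_pos hc, if_neg hc.ne, add_zero, neg_one_mul]
      exact eq_neg_of_add_eq_zero_right this
    · rw [hc, if_neg (lt_irrefl a), if_pos rfl, zero_add, Finset.sum_congr rfl (g := fun i =>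
        if a = f i then φ (a, f) else 0)]
      · rw [← Finset.sum_filter, Finset.sum_const, nsmul_eq_mul]
      · intro i _
        split_ifs with h
        · rw [h, Function.update_eq_self]
        · rfl
    · rw [if_neg hc.not_gt, if_neg hc.ne', add_zero, zero_mul]
      exact Finset.sum_eq_zero fun i _ => by rw [hmax c hc]; simp
  rw [h2, Finset.sum_congr rfl fun c _ => h3 c, ← Finset.sum_mul, Pi.smul_apply,
    smul_eq_mul] at h1
  have h4 := mul_right_cancel₀ hf h1
  rw [Finset.sum_add_distrib, Finset.sum_ite_eq', if_pos (Finset.mem_univ a),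
    ← Finset.sum_filter, Finset.sum_const] at h4
  have h5 : (Finset.univ.filter fun c => c < a).card = (a : ℕ) := by
    rw [← Fin.card_Iio a]
    congr 1
    ext c
    simp
  rw [h5] at h4
  have h6 : -(a : ℝ) + ((Finset.univ.filter fun i => a = f i).card : ℝ) = l := by
    have := congrArg Complex.re h4
    simpa using this
  have h7 : ((a : ℕ) : ℝ) + 1 ≤ d := by exact_mod_cast a.2
  have h8 : (0 : ℝ) ≤ ((Finset.univ.filter fun i => a = f i).card : ℝ) := Nat.cast_nonneg _
  linarith

lemma exists_eigenvector_swapOp_top (hd : 2 ≤ d) :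
    ∃ ψ : Fin d × (Fin k → Fin d) → ℂ, ψ ≠ 0 ∧
      embSum k (swapOp d) *ᵥ ψ = ((k : ℝ) : ℂ) • ψ := by
  let z : Fin d := ⟨0, by omega⟩
  refine ⟨Pi.single (z, fun _ => z) 1, fun h => by simpa using congrFun h (z, fun _ => z), ?_⟩
  ext ⟨x, f⟩
  rw [embSum_swapOp_mulVec]
  have key : ∀ i, ((f i, Function.update f i x) = (z, fun _ => z)) ↔ (x, f) = (z, fun _ => z) := by
    intro i
    simp only [Prod.mk.injEq]
    constructor
    · rintro ⟨h1, h2⟩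
      refine ⟨by simpa using congrFun h2 i, funext fun j => ?_⟩
      by_cases hj : j = i
      · rw [hj, h1]
      · simpa [hj] using congrFun h2 j
    · rintro ⟨rfl, rfl⟩
      exact ⟨rfl, by simp⟩
  simp only [Pi.single_apply, key, Pi.smul_apply]
  simp

/-! ### Eigenvectors for negative eigenvalues of the sum of the swaps -/

section Antisymmetric

variable {s : ℕ} (c : Option (Option (Fin s)) → Fin d)

/-- The amplitudes of an antisymmetric vector. -/
def antiAmp (w : Option (Option (Fin s)) → Fin d) : ℂ :=
  Matrix.det (Matrix.of fun a b => if w a = c b then (1 : ℂ) else 0)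

lemma antiAmp_swap (w : Option (Option (Fin s)) → Fin d) {a b : Option (Option (Fin s))}
    (hab : a ≠ b) : antiAmp c (w ∘ Equiv.swap a b) = -antiAmp c w := by
  have := Matrix.det_permute (Equiv.swap a b)
    (Matrix.of fun a b => if w a = c b then (1 : ℂ) else 0)
  rw [Equiv.Perm.sign_swap hab] at this
  change Matrix.det ((Matrix.of fun a b => if w a = c b then (1 : ℂ) else 0).submatrix
    (Equiv.swap a b) id) = _
  rw [this]
  simp [antiAmp]

lemma antiAmp_self (hc : Function.Injective c) : antiAmp c c = 1 := by
  have : (Matrix.of fun a b => if c a = c b then (1 : ℂ) else 0) = 1 := by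
    ext a b
    simp [Matrix.one_apply, hc.eq_iff]
  rw [antiAmp, this, Matrix.det_one]

/-- The letters of the word `(x, f)` at `A`, at `B_j`, and at the `B_{r t}`. -/
def letters (r : Fin s → Fin k) (x : Fin d) (f : Fin k → Fin d) (j : Fin k) :
    Option (Option (Fin s)) → Fin d
  | none => x
  | some none => f j
  | some (some t) => f (r t)

open Classical in
/-- Sum over `j ∉ R` of the antisymmetric vectors on `A B_R B_j`, with a fixed letter elsewhere. -/
def hookVec (r : Fin s → Fin k) (z : Fin d × (Fin k → Fin d)) : ℂ :=
  ∑ j ∈ (Finset.univ.image r)ᶜ,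
    if ∀ i ∈ (Finset.univ.image r)ᶜ, i ≠ j → z.2 i = c (some none) then
      antiAmp c (letters r z.1 z.2 j) else 0

/-- At the word spelling `c` on `A` and `B_R`, with the filler letter `c (some none)` elsewhere, all
`k - s` summands equal `1`. -/
lemma hookVec_ne_zero (hc : Function.Injective c) {r : Fin s → Fin k}
    (hr : Function.Injective r) (hs : s < k) : hookVec c r ≠ 0 := by
  classical
  intro h
  let f : Fin k → Fin d := Function.extend r (fun t => c (some (some t))) fun _ => c (some none)
  have hf : ∀ i ∈ (Finset.univ.image r)ᶜ, f i = c (some none) := by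
    intro i hi
    refine Function.extend_apply' _ _ _ ?_
    simpa using hi
  have h1 := congrFun h (c none, f)
  rw [hookVec, Finset.sum_congr rfl (g := fun _ => (1 : ℂ))] at h1
  · rw [Finset.sum_const, nsmul_eq_mul, mul_one, Pi.zero_apply, Nat.cast_eq_zero,
      Finset.card_compl, Finset.card_image_of_injective _ hr] at h1
    simp at h1
    omega
  · intro j hj
    rw [if_pos fun i hi _ => hf i hi]
    have : letters r (c none) f j = c := by
      funext a
      match a with
      | none => rfl
      | some none => exact hf j hj
      | some (some t) =>
        change f (r t) = _
        exact hr.extend_apply _ _ t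
    rw [this, antiAmp_self c hc]

/-- Each of the `s` swaps with a system in `R` gives `-1` by antisymmetry. The swaps with the
remaining systems give `-1` in total: their diagonal terms change the sign of each summand, and the
off-diagonal terms cancel in pairs. -/
lemma embSum_swapOp_hookVec {r : Fin s → Fin k} (hr : Function.Injective r) :
    embSum k (swapOp d) *ᵥ hookVec c r = ((-((s : ℝ) + 1) : ℝ) : ℂ) • hookVec c r := by
  classical
  ext ⟨x, f⟩
  rw [embSum_swapOp_mulVec, Pi.smul_apply, smul_eq_mul,
    ← Finset.sum_add_sum_compl (Finset.univ.image r), Finset.sum_image fun _ _ _ _ h => hr h]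
  set R := (Finset.univ.image r)ᶜ with hR
  have hrR : ∀ t, ∀ j ∈ R, j ≠ r t := by
    intro t j hj h
    rw [hR, Finset.mem_compl] at hj
    exact hj (h ▸ Finset.mem_image_of_mem r (Finset.mem_univ t))
  have h1 : ∀ t, hookVec c r (f (r t), Function.update f (r t) x) = -hookVec c r (x, f) := by
    intro t
    rw [hookVec, hookVec, ← Finset.sum_neg_distrib]
    refine Finset.sum_congr rfl fun j hj => ?_
    have e1 : (∀ i ∈ R, i ≠ j → Function.update f (r t) x i = c (some none)) ↔
        ∀ i ∈ R, i ≠ j → f i = c (some none) :=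
      forall₂_congr fun i hi => by rw [Function.update_of_ne (hrR t i hi)]
    have e2 : letters r (f (r t)) (Function.update f (r t) x) j =
        letters r x f j ∘ Equiv.swap none (some (some t)) := by
      funext a
      match a with
      | none => simp [letters]
      | some none =>
        rw [Function.comp_apply, Equiv.swap_apply_of_ne_of_ne (by simp) (by simp)]
        simp [letters, Function.update_of_ne (hrR t j hj)]
      | some (some u) =>
        by_cases hu : u = t
        · subst hu; simp [letters]
        · rw [Function.comp_apply, Equiv.swap_apply_of_ne_of_ne (by simp) (by simpa using hu)]
          simp [letters, Function.update_of_ne (hr.ne hu)]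
    simp only [← hR]
    rw [e2, antiAmp_swap c _ (by simp)]
    by_cases h : ∀ i ∈ R, i ≠ j → f i = c (some none)
    · rw [if_pos h, if_pos (e1.2 h)]
    · rw [if_neg h, if_neg fun h' => h (e1.1 h'), neg_zero]
  -- The `j`-th summand after the swap of `A` with `Bᵢ`.
  let T : Fin k → Fin k → ℂ := fun i j =>
    if ∀ l ∈ R, l ≠ j → Function.update f i x l = c (some none) then
      antiAmp c (letters r (f i) (Function.update f i x) j) else 0
  have hdiag : ∀ i ∈ R, T i i =
      -(if ∀ l ∈ R, l ≠ i → f l = c (some none) then antiAmp c (letters r x f i) else 0) := by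
    intro i hi
    have e1 : (∀ l ∈ R, l ≠ i → Function.update f i x l = c (some none)) ↔
        ∀ l ∈ R, l ≠ i → f l = c (some none) :=
      forall₂_congr fun l _ => forall_congr' fun hl => by rw [Function.update_of_ne hl]
    have e2 : letters r (f i) (Function.update f i x) i =
        letters r x f i ∘ Equiv.swap none (some none) := by
      funext a
      match a with
      | none => simp [letters]
      | some none => simp [letters]
      | some (some u) =>
        rw [Function.comp_apply, Equiv.swap_apply_of_ne_of_ne (by simp) (by simp)]
        simp [letters, Function.update_of_ne (hrR u i hi).symm]
    simp only [T]
    rw [e2, antiAmp_swap c _ (by simp)]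
    by_cases h : ∀ l ∈ R, l ≠ i → f l = c (some none)
    · rw [if_pos h, if_pos (e1.2 h)]
    · rw [if_neg h, if_neg fun h' => h (e1.1 h'), neg_zero]
  have hanti : ∀ i ∈ R, ∀ j ∈ R, i ≠ j → T i j = -T j i := by
    intro i hi j hj hij
    have e : ∀ i ∈ R, ∀ j ∈ R, i ≠ j →
        (∀ l ∈ R, l ≠ j → Function.update f i x l = c (some none)) →
        ∀ l ∈ R, l ≠ i → Function.update f j x l = c (some none) := by
      intro i hi j hj hij h l hl hli
      by_cases hlj : l = j
      · subst hlj
        simpa using h i hi hij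
      · have := h l hl hlj
        rw [Function.update_of_ne hli] at this
        rwa [Function.update_of_ne hlj]
    have e2 : letters r (f i) (Function.update f i x) j =
        letters r (f j) (Function.update f j x) i ∘ Equiv.swap none (some none) := by
      funext a
      match a with
      | none => simp [letters, Function.update_of_ne hij]
      | some none => simp [letters, Function.update_of_ne hij.symm]
      | some (some u) =>
        rw [Function.comp_apply, Equiv.swap_apply_of_ne_of_ne (by simp) (by simp)]
        simp [letters, Function.update_of_ne (hrR u i hi).symm,
          Function.update_of_ne (hrR u j hj).symm]
    simp only [T]
    rw [e2, antiAmp_swap c _ (by simp)]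
    by_cases h : ∀ l ∈ R, l ≠ j → Function.update f i x l = c (some none)
    · rw [if_pos h, if_pos (e i hi j hj hij h)]
    · rw [if_neg h, if_neg fun h' => h (e j hj i hi hij.symm h'), neg_zero]
  have hoff : ∑ i ∈ R, ∑ j ∈ R, (if i = j then 0 else T i j) = 0 := by
    have : ∑ i ∈ R, ∑ j ∈ R, (if i = j then 0 else T i j) =
        -∑ i ∈ R, ∑ j ∈ R, (if i = j then 0 else T i j) := by
      conv_lhs => rw [Finset.sum_comm]
      rw [← Finset.sum_neg_distrib]
      refine Finset.sum_congr rfl fun i hi => ?_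
      rw [← Finset.sum_neg_distrib]
      refine Finset.sum_congr rfl fun j hj => ?_
      by_cases h : i = j
      · simp [h]
      · rw [if_neg h, if_neg (Ne.symm h), hanti j hj i hi (Ne.symm h)]
    exact self_eq_neg.1 this
  have h2 : ∑ i ∈ R, hookVec c r (f i, Function.update f i x) = -hookVec c r (x, f) := by
    have e : ∀ i ∈ R, hookVec c r (f i, Function.update f i x) =
        T i i + ∑ j ∈ R, (if i = j then 0 else T i j) := by
      intro i hi
      have : hookVec c r (f i, Function.update f i x) = ∑ j ∈ R, T i j := rfl
      rw [this, ← Finset.add_sum_erase R _ hi, ← Finset.add_sum_erase R (fun j =>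
        if i = j then 0 else T i j) hi, if_pos rfl, zero_add]
      congr 1
      exact Finset.sum_congr rfl fun j hj => by rw [if_neg (Finset.ne_of_mem_erase hj).symm]
    rw [Finset.sum_congr rfl e, Finset.sum_add_distrib, hoff, add_zero,
      Finset.sum_congr rfl hdiag, Finset.sum_neg_distrib]
    rfl
  rw [h2, Finset.sum_congr rfl fun t _ => h1 t, Finset.sum_const, Finset.card_univ,
    Fintype.card_fin, nsmul_eq_mul]
  push_cast
  ring

end Antisymmetric

lemma exists_eigenvector_swapOp_bot {m : ℕ} (hm : 1 ≤ m) (hmk : m ≤ k) (hmd : m + 1 ≤ d) :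
    ∃ ψ : Fin d × (Fin k → Fin d) → ℂ, ψ ≠ 0 ∧
      embSum k (swapOp d) *ᵥ ψ = ((-(m : ℝ) : ℝ) : ℂ) • ψ := by
  obtain ⟨s, rfl⟩ : ∃ s, m = s + 1 := ⟨m - 1, by omega⟩
  obtain ⟨c⟩ : Nonempty (Option (Option (Fin s)) ↪ Fin d) :=
    Function.Embedding.nonempty_of_card_le (by simpa using hmd)
  have hr : Function.Injective (Fin.castLE (by omega : s ≤ k)) := Fin.castLE_injective _
  refine ⟨hookVec c (Fin.castLE (by omega)), hookVec_ne_zero c c.injective hr (by omega), ?_⟩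
  rw [embSum_swapOp_hookVec c hr]
  push_cast
  rfl

/-! ### The sum of the unnormalized maximally entangled projections -/

/-- The operator `d Φ^d`. -/
def bellOp (d : ℕ) : Matrix (Fin d × Fin d) (Fin d × Fin d) ℂ :=
  fun x y => if x.1 = x.2 ∧ y.1 = y.2 then 1 else 0

/-- Contraction of `A` with `B_i`. -/
def contract (ψ : Fin d × (Fin k → Fin d) → ℂ) (i : Fin k) (f : Fin k → Fin d) : ℂ :=
  ∑ b, ψ (b, Function.update f i b)

/-- Sum over `i` of maximally entangled vectors on `A B_i` times `u i`. -/
def insertBell (u : Fin k → (Fin k → Fin d) → ℂ) (z : Fin d × (Fin k → Fin d)) : ℂ :=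
  ∑ i, if z.1 = z.2 i then u i z.2 else 0

/-- The operator factors as insertion after contraction; its nonzero eigenvalues are found from the
opposite composition, which acts on the contracted amplitudes. -/
lemma embSum_bellOp_mulVec (ψ : Fin d × (Fin k → Fin d) → ℂ) :
    embSum k (bellOp d) *ᵥ ψ = insertBell (contract ψ) := by
  ext ⟨x, f⟩
  rw [embSum, Matrix.sum_mulVec, Finset.sum_apply, insertBell]
  refine Finset.sum_congr rfl fun i _ => ?_
  rw [emb_mulVec]
  simp only [bellOp, contract, ite_and]
  split_ifs <;> simp

/-- The hypothesis says that `u i` does not depend on the letter of `Bᵢ`. Closing the loop on `A Bⱼ`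
gives `d`, while each other `i` moves its letter to position `j`. -/
lemma contract_insertBell {u : Fin k → (Fin k → Fin d) → ℂ}
    (hu : ∀ i f b, u i (Function.update f i b) = u i f) (j : Fin k) (f : Fin k → Fin d) :
    contract (insertBell u) j f =
      d * u j f + ∑ i ∈ Finset.univ.erase j, u i (Function.update f j (f i)) := by
  simp only [contract, insertBell]
  rw [Finset.sum_comm, ← Finset.add_sum_erase _ _ (Finset.mem_univ j)]
  congr 1
  · simp [hu]
  · refine Finset.sum_congr rfl fun i hi => ?_
    simp [Function.update_of_ne (Finset.ne_of_mem_erase hi)]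

lemma contract_update (ψ : Fin d × (Fin k → Fin d) → ℂ) (i : Fin k) (f : Fin k → Fin d)
    (b : Fin d) : contract ψ i (Function.update f i b) = contract ψ i f := by
  simp [contract]

/-- A maximum principle: at the entry of largest modulus of the contraction, the eigenvalue equation
bounds `|l - d|` by the `k - 1` remaining terms. -/
lemma eigenvalue_bellOp_le (hd : 2 ≤ d) (hk : 2 ≤ k) {l : ℝ}
    {ψ : Fin d × (Fin k → Fin d) → ℂ} (hψ : ψ ≠ 0)
    (he : embSum k (bellOp d) *ᵥ ψ = (l : ℂ) • ψ) : l ≤ (d : ℝ) + k - 1 := by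
  rw [embSum_bellOp_mulVec] at he
  have hd' : (2 : ℝ) ≤ d := by exact_mod_cast hd
  have hk' : (2 : ℝ) ≤ k := by exact_mod_cast hk
  have : Nonempty (Fin k) := ⟨⟨0, by omega⟩⟩
  have : Nonempty (Fin d) := ⟨⟨0, by omega⟩⟩
  obtain ⟨⟨j, f⟩, hmax⟩ := Finite.exists_max
    fun z : Fin k × (Fin k → Fin d) => ‖contract ψ z.1 z.2‖
  have h1 : (l : ℂ) * contract ψ j f =
      d * contract ψ j f + ∑ i ∈ Finset.univ.erase j, contract ψ i (Function.update f j (f i)) := by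
    rw [← contract_insertBell (contract_update ψ), he]
    simp [contract, Finset.mul_sum]
  -- If the largest contraction vanishes, all do, and then `l = 0`.
  by_cases h0 : contract ψ j f = 0
  · have h2 : contract ψ = 0 := by
      funext i g
      have := hmax (i, g)
      simp only [h0, norm_zero] at this
      exact norm_le_zero_iff.1 this
    have h3 : (l : ℂ) • ψ = 0 := by
      rw [← he, h2]
      ext z
      simp [insertBell]
    have h4 : l = 0 := by simpa using (smul_eq_zero.1 h3).resolve_right hψ
    linarith
  · have h2 : ((l - d : ℝ) : ℂ) * contract ψ j f =
        ∑ i ∈ Finset.univ.erase j, contract ψ i (Function.update f j (f i)) := by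
      push_cast
      linear_combination h1
    have h3 : |l - d| * ‖contract ψ j f‖ ≤ (k - 1) * ‖contract ψ j f‖ := by
      rw [← Real.norm_eq_abs, ← Complex.norm_real, ← norm_mul, h2]
      refine (norm_sum_le_of_le _ fun i _ => hmax (i, Function.update f j (f i))).trans ?_
      rw [Finset.sum_const, Finset.card_erase_of_mem (Finset.mem_univ j), Finset.card_univ,
        Fintype.card_fin, nsmul_eq_mul, Nat.cast_sub (by omega), Nat.cast_one]
    have h4 := le_of_mul_le_mul_right h3 (norm_pos_iff.2 h0)
    linarith [le_abs_self (l - d)]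

lemma exists_eigenvector_bellOp_top (hd : 2 ≤ d) (hk : 2 ≤ k) :
    ∃ ψ : Fin d × (Fin k → Fin d) → ℂ, ψ ≠ 0 ∧
      embSum k (bellOp d) *ᵥ ψ = (((d : ℝ) + k - 1 : ℝ) : ℂ) • ψ := by
  classical
  let z : Fin d := ⟨0, by omega⟩
  -- A fixed letter on all systems but `Bᵢ` makes the terms of the maximum principle equal, so the
  -- bound is attained.
  let u : Fin k → (Fin k → Fin d) → ℂ := fun i f => if ∀ j, j ≠ i → f j = z then 1 else 0
  have hu : ∀ i f b, u i (Function.update f i b) = u i f := by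
    intro i f b
    have : (∀ j, j ≠ i → Function.update f i b j = z) ↔ ∀ j, j ≠ i → f j = z :=
      forall₂_congr fun j hj => by rw [Function.update_of_ne hj]
    simp only [u, this]
  refine ⟨insertBell u, fun h => ?_, ?_⟩
  · have := congrFun h (z, fun _ => z)
    simp [insertBell, u] at this
    omega
  · have hc : contract (insertBell u) = (((d : ℝ) + k - 1 : ℝ) : ℂ) • u := by
      funext j f
      have h1 : ∀ i ∈ Finset.univ.erase j, u i (Function.update f j (f i)) = u j f := by
        intro i hi
        have hij := Finset.ne_of_mem_erase hi
        have : (∀ l, l ≠ i → Function.update f j (f i) l = z) ↔ ∀ l, l ≠ j → f l = z := by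
          constructor
          · intro h l hl
            by_cases hli : l = i
            · rw [hli]
              simpa using h j hij.symm
            · simpa [hl] using h l hli
          · intro h l hl
            by_cases hlj : l = j
            · rw [hlj]
              simpa using h i hij
            · simpa [hlj] using h l hlj
        simp only [u, this]
      rw [contract_insertBell hu, Finset.sum_congr rfl h1, Finset.sum_const,
        Finset.card_erase_of_mem (Finset.mem_univ j), Finset.card_univ, Fintype.card_fin,
        nsmul_eq_mul, Nat.cast_sub (by omega), Nat.cast_one, Pi.smul_apply, Pi.smul_apply,
        smul_eq_mul]
      push_cast
      ring
    rw [embSum_bellOp_mulVec, hc]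
    ext x
    simp [insertBell, Finset.mul_sum]

/-- In a product vector whose letter at `A` differs from the letter at every `Bᵢ`, all contractions
vanish. -/
lemma exists_eigenvector_bellOp_bot (hd : 2 ≤ d) :
    ∃ ψ : Fin d × (Fin k → Fin d) → ℂ, ψ ≠ 0 ∧
      embSum k (bellOp d) *ᵥ ψ = ((0 : ℝ) : ℂ) • ψ := by
  let z : Fin d := ⟨0, by omega⟩
  let o : Fin d := ⟨1, by omega⟩
  refine ⟨Pi.single (z, fun _ => o) 1, fun h => by simpa using congrFun h (z, fun _ => o), ?_⟩
  have hc : contract (Pi.single (z, fun _ : Fin k => o) (1 : ℂ)) = 0 := by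
    funext i f
    refine Finset.sum_eq_zero fun b _ => ?_
    refine Pi.single_eq_of_ne ?_ _
    intro h
    rw [Prod.mk.injEq] at h
    have h2 := congrFun h.2 i
    rw [Function.update_self, h.1] at h2
    simp [z, o] at h2
  rw [embSum_bellOp_mulVec, hc]
  ext x
  simp [insertBell]

end Spectra

section Thresholds

variable {d k : ℕ}

/-! ### Werner states -/

lemma trace_antiProj_mul (σ : Matrix (Fin d × Fin d) (Fin d × Fin d) ℂ) (hσ : σ.trace = 1) :
    (antiProj d * σ).trace = (1 - (swapOp d * σ).trace) / 2 := by
  rw [antiProj, smul_mul_assoc, Matrix.trace_smul, sub_mul, Matrix.trace_sub, one_mul, hσ,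
    Complex.real_smul]
  push_cast
  ring

lemma blockState_antiProj_mem_EXT (hd : 2 ≤ d) (hk : 2 ≤ k) {c : ℝ}
    (h : ∃ ψ : Fin d × (Fin k → Fin d) → ℂ, ψ ≠ 0 ∧
      embSum k (swapOp d) *ᵥ ψ = (c : ℂ) • ψ) :
    blockState (antiProj d) ((d : ℝ) * (d - 1) / 2) ((d : ℝ) * (d + 1) / 2) ((1 - c / k) / 2) ∈
      EXT (Fin d) (Fin d) k hk := by
  obtain ⟨ψ, hψ, he⟩ := h
  obtain ⟨σ, hσ, htr, hcomm⟩ := exists_mem_EXT_of_eigenvector hk swapOp_isHermitian hψ he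
  obtain ⟨a, b, hab⟩ := exists_eq_of_commute hd fun X => hcomm X X (swapOp_commute X)
  have := eq_blockState_of_eq (isBlockProj_antiProj hd) hσ.1 hab (q := (1 - c / k) / 2) (by
    rw [trace_antiProj_mul σ hσ.1.2, htr]
    push_cast
    rfl)
  rwa [← this]

lemma wernerThr_pos (hd : 2 ≤ d) (k : ℕ) : 0 < wernerThr d k := by
  have hd' : (2 : ℝ) ≤ d := by exact_mod_cast hd
  have : (0 : ℝ) ≤ ((d : ℝ) - 1) / k := div_nonneg (by linarith) (Nat.cast_nonneg k)
  rw [wernerThr]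
  linarith

lemma werner_mem_EXT (hd : 2 ≤ d) (hk : 2 ≤ k) {q : ℝ}
    (hq : q ∈ Set.Icc (0 : ℝ) (min 1 (wernerThr d k))) :
    blockState (antiProj d) ((d : ℝ) * (d - 1) / 2) ((d : ℝ) * (d + 1) / 2) q ∈
      EXT (Fin d) (Fin d) k hk := by
  have hk0 : (0 : ℝ) < k := by exact_mod_cast (by omega : 0 < k)
  have h0 := blockState_antiProj_mem_EXT hd hk (exists_eigenvector_swapOp_top hd)
  rw [div_self hk0.ne', sub_self, zero_div] at h0
  -- The antisymmetric vector lives on `m + 1` systems, so `m` is limited both by `d - 1` letters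
  -- and by `k` systems. The resulting weight is `min 1 w`.
  have h1 := blockState_antiProj_mem_EXT hd hk
    (exists_eigenvector_swapOp_bot (d := d) (k := k) (m := min (d - 1) k)
      (le_min (by omega) (by omega)) (min_le_right _ _)
      (by have := min_le_left (d - 1) k; omega))
  have h2 : min 1 (wernerThr d k) ≤ (1 - -((min (d - 1) k : ℕ) : ℝ) / k) / 2 := by
    rcases le_total (d - 1) k with h | h
    · rw [min_eq_left h, Nat.cast_sub (by omega), Nat.cast_one]
      refine (min_le_right _ _).trans (le_of_eq ?_)
      rw [wernerThr]
      ring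
    · rw [min_eq_right h, neg_div, div_self hk0.ne']
      refine (min_le_left _ _).trans (le_of_eq ?_)
      norm_num
  exact blockState_mem_EXT hk h0 h1
    (lt_of_lt_of_le (lt_min one_pos (wernerThr_pos hd k)) h2) ⟨hq.1, hq.2.trans h2⟩

lemma trace_antiProj_le (hk : 2 ≤ k) {σ : Matrix (Fin d × Fin d) (Fin d × Fin d) ℂ}
    (hσ : σ ∈ EXT (Fin d) (Fin d) k hk) : (antiProj d * σ).trace.re ≤ wernerThr d k := by
  have hneg : embSum k (-swapOp d) = -embSum k (swapOp d) := by
    rw [embSum, embSum, ← Finset.sum_neg_distrib]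
    refine Finset.sum_congr rfl fun i _ => ?_
    rw [← zero_sub, emb_sub, emb_zero, zero_sub]
  have h := trace_mul_le_of_mem_EXT hk (M := -swapOp d) (μ := (d : ℝ) - 1)
    swapOp_isHermitian.neg (by
      intro l ψ hψ he
      rw [hneg, Matrix.neg_mulVec, neg_eq_iff_eq_neg, ← neg_smul, ← Complex.ofReal_neg] at he
      linarith [eigenvalue_swapOp_ge hψ he]) hσ
  rw [neg_mul, Matrix.trace_neg, Complex.neg_re] at h
  have h2 : (antiProj d * σ).trace.re = (1 - (swapOp d * σ).trace.re) / 2 := by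
    rw [trace_antiProj_mul σ hσ.1.2]
    simp
  rw [h2, wernerThr]
  linarith

/-! ### Isotropic states -/

lemma bellOp_eq_smul_maxEnt (hd : 2 ≤ d) : bellOp d = (d : ℂ) • maxEnt d := by
  have hd' : (d : ℂ) ≠ 0 := by exact_mod_cast (by omega : d ≠ 0)
  ext x y
  simp only [bellOp, maxEnt, Matrix.smul_apply, smul_eq_mul, mul_ite, mul_zero]
  rw [mul_one_div_cancel hd']

lemma bellOp_isHermitian : (bellOp d).IsHermitian := by
  ext x y
  simp only [bellOp, Matrix.conjTranspose_apply, apply_ite star, star_one, star_zero, and_comm]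

lemma bellOp_mul_self : bellOp d * bellOp d = (d : ℂ) • bellOp d := by
  ext x y
  simp only [Matrix.mul_apply, bellOp, Fintype.sum_prod_type, ite_and, Matrix.smul_apply,
    smul_eq_mul]
  split_ifs <;> simp

lemma trace_bellOp : (bellOp d).trace = d := by
  rw [Matrix.trace, Fintype.sum_prod_type]
  simp [bellOp]

lemma maxEnt_eq_smul_bellOp (d : ℕ) : maxEnt d = (d : ℝ)⁻¹ • bellOp d := by
  ext x y
  simp [bellOp, maxEnt]

lemma isBlockProj_maxEnt (hd : 2 ≤ d) : IsBlockProj (maxEnt d) 1 ((d : ℝ) ^ 2 - 1) := by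
  have hd' : (2 : ℝ) ≤ d := by exact_mod_cast hd
  have hd0 : (d : ℂ) ≠ 0 := by exact_mod_cast (by omega : d ≠ 0)
  have htr : (maxEnt d).trace = 1 := by
    rw [maxEnt_eq_smul_bellOp, Matrix.trace_smul, trace_bellOp, Complex.real_smul]
    push_cast
    exact inv_mul_cancel₀ hd0
  refine ⟨?_, ?_, one_pos, by nlinarith, by rw [htr]; simp, ?_⟩
  · rw [maxEnt_eq_smul_bellOp]
    exact bellOp_isHermitian.smul (IsSelfAdjoint.all _)
  · have h := maxEnt_eq_smul_bellOp d
    conv_lhs => rw [h]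
    rw [smul_mul_assoc, mul_smul_comm, bellOp_mul_self]
    ext x y
    simp only [Matrix.smul_apply, h, Complex.real_smul, smul_eq_mul, Complex.ofReal_inv,
      Complex.ofReal_natCast]
    field_simp
  · rw [Matrix.trace_sub, htr, Matrix.trace_one]
    simp
    ring

lemma isotropic_eq_blockState (t : ℝ) (d : ℕ) :
    isotropic t d = blockState (maxEnt d) 1 ((d : ℝ) ^ 2 - 1) t := by
  rw [isotropic, blockState, div_one]

lemma mul_gen_apply (M : Matrix (Fin d × Fin d) (Fin d × Fin d) ℂ)
    (X Y : Matrix (Fin d) (Fin d) ℂ) (x y : Fin d × Fin d) :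
    (M * (X ⊗ₖ 1 + 1 ⊗ₖ Y) : Matrix (Fin d × Fin d) (Fin d × Fin d) ℂ) x y =
      ∑ a, M x (a, y.2) * X a y.1 + ∑ b, M x (y.1, b) * Y b y.2 := by
  rw [mul_add, Matrix.add_apply, Matrix.mul_apply, Matrix.mul_apply, Fintype.sum_prod_type,
    Fintype.sum_prod_type]
  simp [Matrix.one_apply]

lemma gen_mul_apply (M : Matrix (Fin d × Fin d) (Fin d × Fin d) ℂ)
    (X Y : Matrix (Fin d) (Fin d) ℂ) (x y : Fin d × Fin d) :
    ((X ⊗ₖ 1 + 1 ⊗ₖ Y) * M : Matrix (Fin d × Fin d) (Fin d × Fin d) ℂ) x y =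
      ∑ a, X x.1 a * M (a, x.2) y + ∑ b, Y x.2 b * M (x.1, b) y := by
  rw [add_mul, Matrix.add_apply, Matrix.mul_apply, Matrix.mul_apply, Fintype.sum_prod_type,
    Fintype.sum_prod_type]
  simp [Matrix.one_apply]

lemma bellOp_commute (X : Matrix (Fin d) (Fin d) ℂ) :
    Commute (bellOp d) ((-Xᵀ) ⊗ₖ 1 + 1 ⊗ₖ X) := by
  change _ = _
  ext x y
  rw [mul_gen_apply, gen_mul_apply]
  simp [bellOp, ite_and, Finset.sum_ite_irrel]
  split_ifs <;> simp

/-- Partial transposition of the first system. -/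
def partialTranspose (M : Matrix (Fin d × Fin d) (Fin d × Fin d) ℂ) :
    Matrix (Fin d × Fin d) (Fin d × Fin d) ℂ :=
  fun x y => M (y.1, x.2) (x.1, y.2)

/-- Transposing `A` turns multiplication by `-Xᵀ` on one side into multiplication by `-X` on the
other, so the `A` terms trade sides in the commutation equation. -/
lemma partialTranspose_commute {σ : Matrix (Fin d × Fin d) (Fin d × Fin d) ℂ}
    {X : Matrix (Fin d) (Fin d) ℂ} (h : Commute σ ((-Xᵀ) ⊗ₖ 1 + 1 ⊗ₖ X)) :
    Commute (partialTranspose σ) (X ⊗ₖ 1 + 1 ⊗ₖ X) := by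
  change _ = _
  ext x y
  have h1 := congrFun (congrFun h.eq (y.1, x.2)) (x.1, y.2)
  rw [mul_gen_apply, gen_mul_apply] at h1 ⊢
  simp only [Matrix.neg_apply, Matrix.transpose_apply, mul_neg, neg_mul,
    Finset.sum_neg_distrib] at h1
  simp only [partialTranspose, mul_comm (X _ _)] at h1 ⊢
  linear_combination h1

lemma exists_eq_maxEnt_of_commute (hd : 2 ≤ d) {σ : Matrix (Fin d × Fin d) (Fin d × Fin d) ℂ}
    (h : ∀ X : Matrix (Fin d) (Fin d) ℂ, Commute σ ((-Xᵀ) ⊗ₖ 1 + 1 ⊗ₖ X)) :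
    ∃ c c' : ℂ, σ = c • maxEnt d + c' • (1 - maxEnt d) := by
  obtain ⟨a, b, hab⟩ := exists_eq_of_commute hd fun X => partialTranspose_commute (h X)
  -- The partial transpose of `σ` is `(a+b)/2 + (b-a)/2 F`, and transposing back turns `F` into `d
  -- Φ^d`.
  refine ⟨(a + b) / 2 + (b - a) / 2 * d, (a + b) / 2, ?_⟩
  have hb : ∀ x y, (bellOp d) x y = d * (maxEnt d) x y := fun x y => by
    rw [bellOp_eq_smul_maxEnt hd, Matrix.smul_apply, smul_eq_mul]
  ext x y
  have h1 := congrFun (congrFun hab (y.1, x.2)) (x.1, y.2)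
  have h2 : swapOp d (y.1, x.2) (x.1, y.2) = bellOp d x y := by
    simp only [swapOp, bellOp]
    exact if_congr ⟨fun h => ⟨h.2.symm, h.1⟩, fun h => ⟨h.2, h.1.symm⟩⟩ rfl rfl
  have h3 : (1 : Matrix (Fin d × Fin d) (Fin d × Fin d) ℂ) (y.1, x.2) (x.1, y.2) =
      (1 : Matrix (Fin d × Fin d) (Fin d × Fin d) ℂ) x y := by
    simp only [Matrix.one_apply, Prod.ext_iff, eq_comm (a := y.1)]
  simp only [partialTranspose, antiProj, Matrix.add_apply, Matrix.smul_apply, Matrix.sub_apply,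
    h2, h3, hb, smul_eq_mul, Complex.real_smul] at h1 ⊢
  rw [h1]
  push_cast
  ring

lemma trace_maxEnt_mul (σ : Matrix (Fin d × Fin d) (Fin d × Fin d) ℂ) :
    (maxEnt d * σ).trace = (d : ℂ)⁻¹ * (bellOp d * σ).trace := by
  rw [maxEnt_eq_smul_bellOp, smul_mul_assoc, Matrix.trace_smul, Complex.real_smul]
  push_cast
  rfl

lemma blockState_maxEnt_mem_EXT (hd : 2 ≤ d) (hk : 2 ≤ k) {c : ℝ}
    (h : ∃ ψ : Fin d × (Fin k → Fin d) → ℂ, ψ ≠ 0 ∧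
      embSum k (bellOp d) *ᵥ ψ = (c : ℂ) • ψ) :
    blockState (maxEnt d) 1 ((d : ℝ) ^ 2 - 1) ((d : ℝ)⁻¹ * (c / k)) ∈
      EXT (Fin d) (Fin d) k hk := by
  obtain ⟨ψ, hψ, he⟩ := h
  obtain ⟨σ, hσ, htr, hcomm⟩ := exists_mem_EXT_of_eigenvector hk bellOp_isHermitian hψ he
  obtain ⟨a, b, hab⟩ := exists_eq_maxEnt_of_commute hd fun X => hcomm (-Xᵀ) X (bellOp_commute X)
  have := eq_blockState_of_eq (isBlockProj_maxEnt hd) hσ.1 hab (q := (d : ℝ)⁻¹ * (c / k)) (by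
    rw [trace_maxEnt_mul, htr]
    push_cast
    rfl)
  rwa [← this]

lemma isoThr_eq (hk : 2 ≤ k) : isoThr d k = (d : ℝ)⁻¹ * (((d : ℝ) + k - 1) / k) := by
  have hk0 : (0 : ℝ) < k := by exact_mod_cast (by omega : 0 < k)
  rw [isoThr]
  field_simp
  ring

lemma isoThr_pos (hd : 2 ≤ d) (k : ℕ) : 0 < isoThr d k := by
  have hd' : (2 : ℝ) ≤ d := by exact_mod_cast hd
  have : (0 : ℝ) ≤ ((d : ℝ) - 1) / k := div_nonneg (by linarith) (Nat.cast_nonneg k)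
  rw [isoThr]
  positivity

lemma isoThr_le_one (hd : 2 ≤ d) (hk : 2 ≤ k) : isoThr d k ≤ 1 := by
  have hd' : (2 : ℝ) ≤ d := by exact_mod_cast hd
  have hk' : (2 : ℝ) ≤ k := by exact_mod_cast hk
  have : ((d : ℝ) - 1) / k ≤ d - 1 := div_le_self (by linarith) (by linarith)
  rw [isoThr, one_div, inv_mul_le_iff₀ (by linarith)]
  linarith

lemma isotropic_mem_EXT (hd : 2 ≤ d) (hk : 2 ≤ k) {q : ℝ}
    (hq : q ∈ Set.Icc (0 : ℝ) (isoThr d k)) :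
    blockState (maxEnt d) 1 ((d : ℝ) ^ 2 - 1) q ∈ EXT (Fin d) (Fin d) k hk := by
  have h0 := blockState_maxEnt_mem_EXT hd hk (exists_eigenvector_bellOp_bot hd)
  rw [zero_div, mul_zero] at h0
  have h1 := blockState_maxEnt_mem_EXT hd hk (exists_eigenvector_bellOp_top hd hk)
  rw [← isoThr_eq hk] at h1
  exact blockState_mem_EXT hk h0 h1 (isoThr_pos hd k) hq

lemma trace_maxEnt_le (hd : 2 ≤ d) (hk : 2 ≤ k)
    {σ : Matrix (Fin d × Fin d) (Fin d × Fin d) ℂ}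
    (hσ : σ ∈ EXT (Fin d) (Fin d) k hk) : (maxEnt d * σ).trace.re ≤ isoThr d k := by
  have h := trace_mul_le_of_mem_EXT hk (M := bellOp d) (μ := (d : ℝ) + k - 1)
    bellOp_isHermitian (fun l ψ hψ he => eigenvalue_bellOp_le hd hk hψ he) hσ
  have h2 : (maxEnt d * σ).trace.re = (d : ℝ)⁻¹ * (bellOp d * σ).trace.re := by
    rw [trace_maxEnt_mul, ← Complex.ofReal_natCast, ← Complex.ofReal_inv, Complex.re_ofReal_mul]
  rw [h2, isoThr_eq hk]
  exact mul_le_mul_of_nonneg_left h (inv_nonneg.2 (Nat.cast_nonneg d))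

/-! ### The closed forms for both families -/

lemma HasBinaryForm.hasClosedForms {D : DivergenceFamily} {b : ℝ → ℝ → ℝ}
    (hD : HasBinaryForm D b) (hd : 2 ≤ d) (hk : 2 ≤ k) : HasClosedForms D d k hk := by
  constructor
  · intro p hp
    rw [werner_eq_blockState]
    exact hD.iInf_eq_closedForm (isBlockProj_antiProj hd) (wernerThr_pos hd k)
      (fun σ hσ => ⟨hσ.1, trace_antiProj_le hk hσ⟩) (fun q hq => werner_mem_EXT hd hk hq) hp
  · intro t ht
    rw [isotropic_eq_blockState]
    exact hD.iInf_eq_closedForm (isBlockProj_maxEnt hd) (isoThr_pos hd k)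
      (fun σ hσ => ⟨hσ.1, trace_maxEnt_le hd hk hσ⟩)
      (fun q hq => isotropic_mem_EXT hd hk ⟨hq.1, hq.2.trans (min_le_right _ _)⟩) ht

end Thresholds

end Unext

end

theorem mainTheorem9 (d k : ℕ) (hd : 2 ≤ d) (hk : 2 ≤ k) :
    -- arbitrary generalized divergences
    (∀ D : Unext.DivergenceFamily, Unext.IsGeneralizedDivergence D →
      (∀ p ∈ Set.Icc (0 : ℝ) 1,
        Unext.unextDiv D k hk (Unext.werner p d) =
          ⨅ q ∈ Set.Icc (0 : ℝ) (min 1 (Unext.wernerThr d k)), Unext.binaryDiv D p q) ∧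
      (∀ t ∈ Set.Icc (0 : ℝ) 1,
        Unext.unextDiv D k hk (Unext.isotropic t d) =
          ⨅ q ∈ Set.Icc (0 : ℝ) (Unext.isoThr d k), Unext.binaryDiv D t q)) ∧
    -- closed forms for the relative entropy and the Rényi relative entropies
    Unext.HasClosedForms Unext.relEntropy d k hk ∧
    (∀ α : ℝ, 0 < α → α ≠ 1 → Unext.HasClosedForms (Unext.renyi α) d k hk) ∧
    (∀ α : ℝ, 1 / 2 ≤ α → α ≠ 1 → Unext.HasClosedForms (Unext.sandwichedRenyi α) d k hk) ∧
    -- the binary quantities that occur in the closed forms, written out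
    (∀ p ∈ Set.Icc (0 : ℝ) 1, ∀ q ∈ Set.Ioo (0 : ℝ) 1,
      Unext.binaryDiv Unext.relEntropy p q =
        ((p * Real.logb 2 (p / q) + (1 - p) * Real.logb 2 ((1 - p) / (1 - q)) : ℝ) : EReal) ∧
      ∀ α : ℝ, 0 < α → α ≠ 1 →
        Unext.binaryDiv (Unext.renyi α) p q =
          ((1 / (α - 1) * Real.logb 2
            (p ^ α * q ^ (1 - α) + (1 - p) ^ α * (1 - q) ^ (1 - α)) : ℝ) : EReal) ∧
        Unext.binaryDiv (Unext.sandwichedRenyi α) p q =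
          ((1 / (α - 1) * Real.logb 2
            (p ^ α * q ^ (1 - α) + (1 - p) ^ α * (1 - q) ^ (1 - α)) : ℝ) : EReal)) := by
  refine ⟨fun D hD => ⟨fun p hp => ?_, fun t ht => ?_⟩,
    Unext.hasBinaryForm_relEntropy.hasClosedForms hd hk,
    fun α h0 h1 => (Unext.hasBinaryForm_renyi h0 h1).hasClosedForms hd hk,
    fun α h0 h1 => (Unext.hasBinaryForm_sandwichedRenyi h0 h1).hasClosedForms hd hk,
    fun p hp q hq => ⟨Unext.hasBinaryForm_relEntropy.binaryDiv_eq hp hq, fun α h0 h1 =>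
      ⟨(Unext.hasBinaryForm_renyi h0 h1).binaryDiv_eq hp hq, ?_⟩⟩⟩
  · rw [Unext.werner_eq_blockState]
    exact Unext.iInf_generalizedDivergence hD (Unext.isBlockProj_antiProj hd)
      (fun σ hσ => ⟨hσ.1, Unext.trace_antiProj_le hk hσ⟩)
      (fun q hq => Unext.werner_mem_EXT hd hk hq) hp
  -- The isotropic threshold never exceeds `1`, so the minimum with `1` can be inserted.
  · rw [Unext.isotropic_eq_blockState, ← min_eq_right (Unext.isoThr_le_one hd hk)]
    refine Unext.iInf_generalizedDivergence hD (Unext.isBlockProj_maxEnt hd)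
      (fun σ hσ => ⟨hσ.1, Unext.trace_maxEnt_le hd hk hσ⟩)
      (fun q hq => Unext.isotropic_mem_EXT hd hk ⟨hq.1, hq.2.trans (min_le_right _ _)⟩) ht
  -- The binary formula is claimed for all `α > 0`, while the lower bound in `HasBinaryForm` needs
  -- `α ≥ 1/2`; the value on block states is therefore used directly.
  · rw [Unext.binaryDiv, Unext.kappa_eq_blockState, Unext.kappa_eq_blockState]
    exact Unext.sandwichedRenyi_blockState h0 Unext.isBlockProj_kappaProj hp hq
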